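/- \textbf{Notation.} For a set $\Lambda$, finite sequences in $\Lambda$ are ordered by $s\preceq t$ if $s$ is an initial segment of $t$ and $s\prec t$ if moreover $s\ne t$; $s^\frown t$ is concatenation, and for a set $U$ of finite sequences $MAX(U)$ is the set of $\prec$-maximal members of $U$. For an ordinal $a$ and a sequence $t=(\xi_i)_{i=1}^n$ of ordinals, $a+t=(a+\xi_i)_{i=1}^n$. Put $\Pi T=\{(s,t)\in T\times MAX(T): s\preceq t\}$. \textbf{Trees.} $\Gamma_0=\{(0)\}$. Given $\Gamma_\xi$, let $\Gamma_{\xi,1}=\Gamma_\xi$, $$\Gamma_{\xi,n+1}=\{\omega^\xi n+s: s\in\Gamma_\xi\}\cup\{(\omega^\xi n+t)^\frown u: t\in MAX(\Gamma_\xi),\ u\in\Gamma_{\xi,n}\},$$ and $\Gamma_{\xi+1}=\bigcup_{n\ge1}\Gamma_{\xi,n}$. For a limit ordinal $\xi$, $\Gamma_\xi=\bigcup_{\zeta<\xi}(\omega^\zeta+\Gamma_{\zeta+1})$. \textbf{Weights.} Define $p_\xi:\Pi\Gamma_\xi\to[0,1]$ by $p_0((0),(0))=1$; if $t=(\omega^\xi(n-1)+t_1)^\frown\cdots^\frown(\omega^\xi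 0+t_n)$ with $t_1,\dots,t_n\in MAX(\Gamma_\xi)$ and $s=(\omega^\xi(n-1)+t_1)^\frown\cdots^\frown(\omega^\xi(n-m+1)+t_{m-1})^\frown(\omega^\xi(n-m)+s')$ with $1\le m\le n$ and $\varnothing\prec s'\preceq t_m$, then $p_{\xi+1}(s,t)=\frac1n p_\xi(s',t_m)$; and if $\xi$ is a limit, $\zeta<\xi$ and $(s',t')\in\Pi\Gamma_{\zeta+1}$, then $p_\xi(\omega^\zeta+s',\omega^\zeta+t')=p_{\zeta+1}(s',t')$. The value $p_\xi(s,t)$ does not depend on the maximal extension $t$ of $s$, and $\mathbb P_\xi(s)$ denotes it. Let $D$ be a directed set and let $\Omega_\xi=\Gamma_\xi D$ be the set of finite sequences $\tau=((\xi_i,U_i))_{i=1}^n$ in pairs of an ordinal and a member of $D$ such that $t=(\xi_i)_{i=1}^n\in\Gamma_\xi$; put $\mathbb P_\xi(\tau)=\mathbb P_\xi(t)$. \textbf{Prunings.} An \emph{extended pruning} $(\theta,e):\Omega_\xi\to\Omega_\xi$ is a pair of maps $\theta:\Omega_\xi\to\Omega_\xi$, $e:MAX(\Omega_\xi)\to MAX(\Omega_\xi)$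 such that $\tau\prec\tau'$ implies $\theta(\tau)\prec\theta(\tau')$; if $U$ and $V$ are the last $D$-coordinates of $\tau$ and $\theta(\tau)$, then $U\le_D V$; and $\theta(\tau)\preceq e(\tau)$ for all $\tau\in MAX(\Omega_\xi)$. For $\varepsilon\in\mathbb R$, a function $g:\Pi\Omega_\xi\to\mathbb R$ is \emph{$\varepsilon$-small} if there is an extended pruning $(\theta,e):\Omega_\xi\to\Omega_\xi$ such that $\sum_{\varnothing\prec\tau'\preceq e(\tau)}\mathbb P_\xi(\tau')g(\tau',e(\tau))<\varepsilon$ for every $\tau\in MAX(\Omega_\xi)$. It is \emph{$\varepsilon$-large} if for every $\delta>0$ there is an extended pruning $(\theta,e):\Omega_\xi\to\Omega_\xi$ such that $g(\theta(\tau'),e(\tau))\ge\varepsilon-\delta$ for every $(\tau',\tau)\in\Pi\Omega_\xi$. \textbf{Theorem.} Let $\xi$ be any ordinal and $D$ any directed set. (1) For every $g:\Pi\Omega_\xi\to[-1,1]$ and every $\varepsilon\in\mathbb R$, $g$ is $\varepsilon$-large or $\varepsilon$-small (or both). (2) If $g:\Pi\Omega_\xi\to\mathbb R$ is bounded and $\varepsilon\in\mathbb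 R$ is such that $\sum_{\varnothing\prec\tau'\preceq\tau}\mathbb P_\xi(\tau')g(\tau',\tau)\ge\varepsilon$ for every $\tau\in MAX(\Omega_\xi)$, then $g$ is $\varepsilon$-large. -/

import Mathlib

universe u v

namespace OrdTree

/-! Finite sequences are lists, `s ⪯ t` (initial segment) is `s <+: t`, concatenation is `++`. -/

/-- `MAX(U)`: the members of `U` that are maximal in `U` for the initial segment order. -/
def maxElts {α : Type*} (U : Set (List α)) : Set (List α) :=
  {t | t ∈ U ∧ ∀ s ∈ U, t <+: s → s = t}

/-- A `B`-tree: a set of nonempty finite sequences closed under nonempty initial segments. -/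
def IsBTree {α : Type*} (T : Set (List α)) : Prop :=
  [] ∉ T ∧ ∀ t ∈ T, ∀ s, s ≠ [] → s <+: t → s ∈ T

/-- `Π T = {(s, t) ∈ T × MAX(T) : s ⪯ t}`. -/
def branchPairs {α : Type*} (T : Set (List α)) : Set (List α × List α) :=
  {q | q.1 ∈ T ∧ q.2 ∈ maxElts T ∧ q.1 <+: q.2}

/-- `a + t = (a + t_1, …, a + t_n)`. -/
noncomputable def shift (a : Ordinal.{u}) (t : List Ordinal.{u}) : List Ordinal.{u} :=
  t.map (fun x => a + x)

/-- The trees `Γ_{ξ,n}` built from `G = Γ_ξ`, with the convention `Γ_{ξ,0} = ∅`: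
`Γ_{ξ,n+1} = {ω^ξ n + s : s ∈ G} ∪ {(ω^ξ n + t) ⌢ u : t ∈ MAX(G), u ∈ Γ_{ξ,n}}`. -/
def gammaLevel (ξ : Ordinal.{u}) (G : Set (List Ordinal.{u})) : ℕ → Set (List Ordinal.{u})
  | 0 => ∅
  | n + 1 =>
      {r | ∃ s ∈ G, r = shift (Ordinal.omega0 ^ ξ * n) s} ∪
      {r | ∃ t ∈ maxElts G, ∃ u ∈ gammaLevel ξ G n, r = shift (Ordinal.omega0 ^ ξ * n) t ++ u}

/-- The trees `Γ_ξ`: `Γ_0 = {(0)}`, `Γ_{ξ+1} = ⋃_n Γ_{ξ,n}`, and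
`Γ_ξ = ⋃_{ζ<ξ} (ω^ζ + Γ_{ζ+1})` for limit `ξ`. -/
noncomputable def Gam (ξ : Ordinal.{u}) : Set (List Ordinal.{u}) :=
  Ordinal.limitRecOn (motive := fun _ => Set (List Ordinal.{u})) ξ
    {[0]}
    (fun ξ G => ⋃ n : ℕ, gammaLevel ξ G n)
    (fun _ hξ G => ⋃ ζ, ⋃ hζ, shift (Ordinal.omega0 ^ ζ) '' G (ζ + 1) (hξ.add_one_lt hζ))

theorem Gam_zero : Gam.{u} 0 = {[0]} := by simp [Gam]

theorem Gam_add_one (ξ : Ordinal.{u}) :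
    Gam (ξ + 1) = ⋃ n : ℕ, gammaLevel ξ (Gam ξ) n := by
  simp only [Gam, Ordinal.limitRecOn_add_one]

theorem Gam_limit {ξ : Ordinal.{u}} (hξ : Order.IsSuccLimit ξ) :
    Gam ξ = ⋃ ζ, ⋃ _ : ζ < ξ, shift (Ordinal.omega0 ^ ζ) '' Gam (ζ + 1) := by
  simp only [Gam, Ordinal.limitRecOn_limit _ _ _ _ hξ]

theorem gammaLevel_one (ξ : Ordinal.{u}) (G : Set (List Ordinal.{u})) :
    gammaLevel ξ G 1 = G := by
  simp [gammaLevel, shift]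

theorem isBTree_gammaLevel {ξ : Ordinal.{u}} {G : Set (List Ordinal.{u})} (hG : IsBTree G) (n : ℕ) :
    IsBTree (gammaLevel ξ G n) := by
  induction n with
  | zero => simp [gammaLevel, IsBTree]
  | succ n ih =>
    have key : ∀ t ∈ G, ∀ s, s ≠ [] → s <+: shift (Ordinal.omega0 ^ ξ * n) t →
        s ∈ gammaLevel ξ G (n + 1) := by
      intro t ht s hs hst
      obtain ⟨s', hs', rfl⟩ := List.prefix_map_iff.1 hst
      exact Or.inl ⟨s', hG.2 t ht s' (by rintro rfl; simp at hs) hs', rfl⟩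
    refine ⟨?_, ?_⟩
    · rintro (⟨s, hs, h⟩ | ⟨t, ht, u, hu, h⟩)
      · have : s = [] := by simpa [shift] using h.symm
        exact hG.1 (this ▸ hs)
      · have : u = [] := (List.append_eq_nil_iff.1 h.symm).2
        exact ih.1 (this ▸ hu)
    · rintro r (⟨t, ht, rfl⟩ | ⟨t, ht, u, hu, rfl⟩) s hs hst
      · exact key t ht s hs hst
      · rcases List.prefix_or_prefix_of_prefix hst (List.prefix_append _ u) with h | ⟨s', rfl⟩
        · exact key t ht.1 s hs h
        · have hs' : s' <+: u := (List.prefix_append_right_inj _).1 hst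
          rcases eq_or_ne s' [] with rfl | hne
          · exact key t ht.1 _ hs (by simp)
          · exact Or.inr ⟨t, ht, s', ih.2 u hu s' hne hs', rfl⟩

theorem isBTree_Gam (ξ : Ordinal.{u}) : IsBTree (Gam ξ) := by
  induction ξ using Ordinal.limitRecOn with
  | zero =>
    rw [Gam_zero]
    refine ⟨by simp, ?_⟩
    rintro t rfl s hs hst
    rcases s with _ | ⟨a, s⟩
    · exact absurd rfl hs
    · simpa [List.cons_prefix_cons] using hst
  | add_one ζ ih =>
    rw [Gam_add_one]
    have h := fun n => isBTree_gammaLevel (ξ := ζ) ih n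
    refine ⟨by simpa using fun n => (h n).1, ?_⟩
    intro t ht s hs hst
    obtain ⟨n, hn⟩ := Set.mem_iUnion.1 ht
    exact Set.mem_iUnion.2 ⟨n, (h n).2 t hn s hs hst⟩
  | limit ξ hξ ih =>
    rw [Gam_limit hξ]
    refine ⟨?_, ?_⟩
    · simp only [Set.mem_iUnion, not_exists]
      rintro ζ hζ ⟨t, ht, h⟩
      have : t = [] := by simpa [shift] using h
      exact (ih _ (hξ.add_one_lt hζ)).1 (this ▸ ht)
    · simp only [Set.mem_iUnion]
      rintro _ ⟨ζ, hζ, t, ht, rfl⟩ s hs hst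
      obtain ⟨s', hs', rfl⟩ := List.prefix_map_iff.1 hst
      exact ⟨ζ, hζ, s', (ih _ (hξ.add_one_lt hζ)).2 t ht s' (by rintro rfl; simp at hs) hs', rfl⟩

/-- `levelConcat ξ n [t_1, …, t_m] = (ω^ξ(n-1) + t_1) ⌢ (ω^ξ(n-2) + t_2) ⌢ … ⌢ (ω^ξ(n-m) + t_m)`,
meant for `m ≤ n`. -/
noncomputable def levelConcat (ξ : Ordinal.{u}) : ℕ → List (List Ordinal.{u}) → List Ordinal.{u}
  | _, [] => []
  | 0, _ :: _ => []
  | n + 1, t :: ts => shift (Ordinal.omega0 ^ ξ * n) t ++ levelConcat ξ n ts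

/-- `HasWeight ξ s t w` says that `(s, t) ∈ Π Γ_ξ` and `p_ξ(s, t) = w`, where:
* `p_0((0), (0)) = 1`;
* if `t = (ω^ξ(n-1) + t_1) ⌢ … ⌢ t_n` with `t_1, …, t_n ∈ MAX(Γ_ξ)` and
  `s = (ω^ξ(n-1) + t_1) ⌢ … ⌢ (ω^ξ(n-m+1) + t_{m-1}) ⌢ (ω^ξ(n-m) + s')` with
  `∅ ≠ s' ⪯ t_m`, then `p_{ξ+1}(s, t) = p_ξ(s', t_m) / n`;
  here `l` is `[t_1, …, t_{m-1}]`, `t'` is `t_m` and `r` is `[t_{m+1}, …, t_n]`;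
* for `ξ` a limit, `ζ < ξ` and `(s', t') ∈ Π Γ_{ζ+1}`,
  `p_ξ(ω^ζ + s', ω^ζ + t') = p_{ζ+1}(s', t')`. -/
inductive HasWeight : Ordinal.{u} → List Ordinal.{u} → List Ordinal.{u} → ℝ → Prop
  | zero : HasWeight 0 [0] [0] 1
  | add_one (ξ : Ordinal.{u}) (l : List (List Ordinal.{u})) (t' : List Ordinal.{u})
      (r : List (List Ordinal.{u})) (n : ℕ) (s' : List Ordinal.{u}) (w : ℝ)
      (hn : n = (l ++ t' :: r).length)
      (hmax : ∀ x ∈ l ++ t' :: r, x ∈ maxElts (Gam ξ))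
      (hw : HasWeight ξ s' t' w) :
      HasWeight (ξ + 1) (levelConcat ξ n (l ++ [s'])) (levelConcat ξ n (l ++ t' :: r)) (w / n)
  | limit (ξ ζ : Ordinal.{u}) (s' t' : List Ordinal.{u}) (w : ℝ)
      (hξ : Order.IsSuccLimit ξ) (hζ : ζ < ξ) (hw : HasWeight (ζ + 1) s' t' w) :
      HasWeight ξ (shift (Ordinal.omega0 ^ ζ) s') (shift (Ordinal.omega0 ^ ζ) t') w

open Classical in
/-- `ℙ_ξ(s) = p_ξ(s, t)` for any maximal extension `t` of `s` in `Γ_ξ`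
(and `0` if `s ∉ Γ_ξ`, a value that is never used). -/
noncomputable def prob (ξ : Ordinal.{u}) (s : List Ordinal.{u}) : ℝ :=
  if h : ∃ w t, HasWeight ξ s t w then h.choose else 0

section WellDefined

/-! `ℙ_ξ` is well defined on `Γ_ξ`. -/

open Ordinal

theorem lt_mul_of {ξ : Ordinal.{u}} {x : Ordinal.{u}} (hx : x < omega0 ^ ξ) (n : ℕ) :
    omega0 ^ ξ * n + x < omega0 ^ ξ * (n + 1 : ℕ) := by
  push_cast
  rw [mul_add_one]
  gcongr

theorem gammaLevel_lt {ξ : Ordinal.{u}} {G : Set (List Ordinal.{u})}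
    (hG : ∀ t ∈ G, ∀ x ∈ t, x < omega0 ^ ξ) (n : ℕ) :
    ∀ t ∈ gammaLevel ξ G n, ∀ x ∈ t, x < omega0 ^ ξ * n := by
  have mono : ∀ n : ℕ, omega0 ^ ξ * n ≤ omega0 ^ ξ * (n + 1 : ℕ) := by
    intro n; gcongr; simp
  induction n with
  | zero => simp [gammaLevel]
  | succ n ih =>
    have key : ∀ t ∈ G, ∀ x ∈ shift (omega0 ^ ξ * n) t, x < omega0 ^ ξ * (n + 1 : ℕ) := by
      intro t ht x hx
      obtain ⟨y, hy, rfl⟩ := List.mem_map.1 hx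
      exact lt_mul_of (hG t ht y hy) n
    rintro r (⟨t, ht, rfl⟩ | ⟨t, ht, v, hv, rfl⟩) x hx
    · exact key t ht x hx
    · rcases List.mem_append.1 hx with hx | hx
      · exact key t ht.1 x hx
      · exact (ih v hv x hx).trans_le (mono n)

theorem Gam_lt (ξ : Ordinal.{u}) : ∀ t ∈ Gam ξ, ∀ x ∈ t, x < omega0 ^ ξ := by
  induction ξ using Ordinal.limitRecOn with
  | zero => rw [Gam_zero]; simp
  | add_one ξ ih =>
    rw [Gam_add_one]
    intro t ht x hx
    obtain ⟨n, hn⟩ := Set.mem_iUnion.1 ht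
    refine (gammaLevel_lt ih n t hn x hx).trans ?_
    rw [opow_add, opow_one]
    have := opow_pos ξ omega0_pos
    gcongr
    exact natCast_lt_omega0 n
  | limit ξ hξ ih =>
    rw [Gam_limit hξ]
    simp only [Set.mem_iUnion]
    rintro _ ⟨ζ, hζ, t, ht, rfl⟩ x hx
    obtain ⟨y, hy, rfl⟩ := List.mem_map.1 hx
    have h1 := ih _ (hξ.add_one_lt hζ) t ht y hy
    have hlt : omega0 ^ (ζ + 1) < omega0 ^ ξ :=
      (opow_lt_opow_iff_right one_lt_omega0).2 (hξ.add_one_lt hζ)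
    refine lt_trans ?_ hlt
    refine isPrincipal_add_omega0_opow (ζ + 1) ?_ h1
    exact (opow_lt_opow_iff_right one_lt_omega0).2 (by simp)

theorem log_opow_add (ζ y : Ordinal.{u}) (hy : y < omega0 ^ (ζ + 1)) :
    Ordinal.log omega0 (omega0 ^ ζ + y) = ζ := by
  have hp := opow_pos ζ omega0_pos
  have h1 : omega0 ^ ζ ≤ omega0 ^ ζ + y := by simp
  have h2 : omega0 ^ ζ + y < omega0 ^ (ζ + 1) :=
    isPrincipal_add_omega0_opow (ζ + 1)
      ((opow_lt_opow_iff_right one_lt_omega0).2 (by simp)) hy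
  have h0 : omega0 ^ ζ + y ≠ 0 := (hp.trans_le h1).ne'
  apply le_antisymm
  · exact Order.lt_succ_iff.1 (by
      rw [Order.succ_eq_add_one]
      exact (lt_opow_iff_log_lt one_lt_omega0 h0).1 h2)
  · exact (opow_le_iff_le_log one_lt_omega0 h0).1 h1

theorem levelConcat_lt {ξ : Ordinal.{u}} (l : List (List Ordinal.{u})) (n : ℕ)
    (hl : ∀ t ∈ l, ∀ x ∈ t, x < omega0 ^ ξ) :
    ∀ x ∈ levelConcat ξ n l, x < omega0 ^ ξ * n := by
  have mono : ∀ n : ℕ, omega0 ^ ξ * n ≤ omega0 ^ ξ * (n + 1 : ℕ) := by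
    intro n; gcongr; simp
  induction l generalizing n with
  | nil => simp [levelConcat]
  | cons t l ih =>
    rcases n with _ | n
    · simp [levelConcat]
    · intro x hx
      rcases List.mem_append.1 hx with hx | hx
      · obtain ⟨y, hy, rfl⟩ := List.mem_map.1 hx
        exact lt_mul_of (hl t (by simp) y hy) n
      · exact (ih n (fun t ht => hl t (by simp [ht])) x hx).trans_le (mono n)

theorem shift_inj {a : Ordinal.{u}} {s t : List Ordinal.{u}} (h : shift a s = shift a t) : s = t :=
  List.map_injective_iff.2 (fun x y hxy => by simpa using hxy) h

theorem shift_append_inj {ξ : Ordinal.{u}} {n : ℕ} {s t v w : List Ordinal.{u}}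
    (hv : ∀ x ∈ v, x < omega0 ^ ξ * n) (hw : ∀ x ∈ w, x < omega0 ^ ξ * n)
    (h : shift (omega0 ^ ξ * n) s ++ v = shift (omega0 ^ ξ * n) t ++ w) : s = t ∧ v = w := by
  have e1 : ∀ (s v : List Ordinal.{u}), (∀ x ∈ v, x < omega0 ^ ξ * n) →
      (shift (omega0 ^ ξ * n) s ++ v).filter (fun x => decide (omega0 ^ ξ * n ≤ x))
        = shift (omega0 ^ ξ * n) s := by
    intro s v hv
    rw [List.filter_append, List.filter_eq_self.2, List.filter_eq_nil_iff.2, List.append_nil]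
    · intro x hx; simpa using hv x hx
    · intro x hx
      obtain ⟨y, hy, rfl⟩ := List.mem_map.1 hx
      simp
  have h1 : shift (omega0 ^ ξ * n) s = shift (omega0 ^ ξ * n) t := by
    rw [← e1 s v hv, h, e1 t w hw]
  exact ⟨shift_inj h1, by rw [h1] at h; exact List.append_cancel_left h⟩

theorem levelConcat_ne_nil {ξ : Ordinal.{u}} {n : ℕ} {t : List Ordinal.{u}}
    {l : List (List Ordinal.{u})} (ht : t ≠ []) : levelConcat ξ (n + 1) (t :: l) ≠ [] := by
  simp [levelConcat, shift, ht]

theorem levelConcat_n {ξ : Ordinal.{u}} {n m : ℕ} {t t' : List Ordinal.{u}}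
    {l l' : List (List Ordinal.{u})} (ht : t ≠ []) (ht' : t' ≠ [])
    (hl : ∀ x ∈ t, x < omega0 ^ ξ) (hl' : ∀ x ∈ t', x < omega0 ^ ξ)
    (h : levelConcat ξ (n + 1) (t :: l) = levelConcat ξ (m + 1) (t' :: l')) : n = m := by
  obtain ⟨a, t, rfl⟩ := List.exists_cons_of_ne_nil ht
  obtain ⟨b, t', rfl⟩ := List.exists_cons_of_ne_nil ht'
  simp only [levelConcat, shift, List.map_cons, List.cons_append, List.cons.injEq] at h
  have h1 := congrArg (· / omega0 ^ ξ) h.1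
  have := (opow_pos ξ omega0_pos).ne'
  simp only [mul_add_div _ this, div_eq_zero_of_lt (hl a (by simp)),
    div_eq_zero_of_lt (hl' b (by simp)), add_zero] at h1
  exact_mod_cast h1

theorem levelConcat_last {ξ : Ordinal.{u}} (l : List (List Ordinal.{u})) :
    ∀ (l' : List (List Ordinal.{u})) (n : ℕ) (s s' : List Ordinal.{u}),
    (∀ t ∈ l, t ≠ [] ∧ ∀ x ∈ t, x < omega0 ^ ξ) → (∀ t ∈ l', t ≠ [] ∧ ∀ x ∈ t, x < omega0 ^ ξ) →
    s ≠ [] → s' ≠ [] → (∀ x ∈ s, x < omega0 ^ ξ) → (∀ x ∈ s', x < omega0 ^ ξ) →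
    l.length < n → l'.length < n →
    levelConcat ξ n (l ++ [s]) = levelConcat ξ n (l' ++ [s']) → s = s' := by
  induction l with
  | nil =>
    intro l' n s s' hl hl' hs hs' hb hb' hn hn' h
    obtain ⟨n, rfl⟩ := Nat.exists_eq_succ_of_ne_zero (by omega : n ≠ 0)
    rcases l' with _ | ⟨t, l'⟩
    · exact (shift_append_inj (by simp [levelConcat]) (by simp [levelConcat]) h).1
    · exfalso
      have hb2 : ∀ x ∈ levelConcat ξ n (l' ++ [s']), x < omega0 ^ ξ * n := by
        apply levelConcat_lt
        intro t ht
        rcases List.mem_append.1 ht with ht | ht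
        · exact (hl' t (by simp [ht])).2
        · simp only [List.mem_singleton] at ht; subst ht; exact hb'
      have h2 := (shift_append_inj (by simp [levelConcat]) hb2 h).2
      obtain ⟨n, rfl⟩ := Nat.exists_eq_succ_of_ne_zero (by simp at hn'; omega : n ≠ 0)
      rcases l' with _ | ⟨a, l'⟩
      · exact levelConcat_ne_nil hs' h2.symm
      · exact levelConcat_ne_nil (hl' a (by simp)).1 h2.symm
  | cons t l ih =>
    intro l' n s s' hl hl' hs hs' hb hb' hn hn' h
    obtain ⟨n, rfl⟩ := Nat.exists_eq_succ_of_ne_zero (by omega : n ≠ 0)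
    have B : ∀ (l : List (List Ordinal.{u})) s, (∀ t ∈ l, t ≠ [] ∧ ∀ x ∈ t, x < omega0 ^ ξ) →
        (∀ x ∈ s, x < omega0 ^ ξ) → ∀ x ∈ levelConcat ξ n (l ++ [s]), x < omega0 ^ ξ * n := by
      intro l s hl hs
      apply levelConcat_lt
      intro t ht
      rcases List.mem_append.1 ht with ht | ht
      · exact (hl t ht).2
      · simp only [List.mem_singleton] at ht; subst ht; exact hs
    have hl2 : ∀ t ∈ l, t ≠ [] ∧ ∀ x ∈ t, x < omega0 ^ ξ := fun t ht => hl t (by simp [ht])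
    rcases l' with _ | ⟨t', l'⟩
    · exfalso
      have h2 := (shift_append_inj (B l s hl2 hb) (by simp [levelConcat]) h).2
      obtain ⟨n, rfl⟩ := Nat.exists_eq_succ_of_ne_zero (by simp at hn; omega : n ≠ 0)
      rcases l with _ | ⟨a, l⟩
      · exact levelConcat_ne_nil hs h2
      · exact levelConcat_ne_nil (hl a (by simp)).1 h2
    · have hl2' : ∀ t ∈ l', t ≠ [] ∧ ∀ x ∈ t, x < omega0 ^ ξ := fun t ht => hl' t (by simp [ht])
      have h2 := (shift_append_inj (B l s hl2 hb) (B l' s' hl2' hb') h).2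
      exact ih l' n s s' hl2 hl2' hs hs' hb hb' (by simpa using hn) (by simpa using hn') h2

theorem HasWeight.isInit {ξ : Ordinal.{u}} {s t : List Ordinal.{u}} {w : ℝ}
    (h : HasWeight ξ s t w) : s ≠ [] ∧ s <+: t ∧ t ∈ Gam ξ := by
  have cat : ∀ (ξ : Ordinal.{u}) (l : List (List Ordinal.{u})) (n : ℕ) (s t r), s ≠ [] → s <+: t →
      l.length < n → levelConcat ξ n (l ++ [s]) ≠ [] ∧
      levelConcat ξ n (l ++ [s]) <+: levelConcat ξ n (l ++ t :: r) := by
    intro ξ l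
    induction l with
    | nil =>
      intro n s t r hs hst hn
      obtain ⟨n, rfl⟩ := Nat.exists_eq_succ_of_ne_zero (by omega : n ≠ 0)
      refine ⟨levelConcat_ne_nil hs, ?_⟩
      simp only [levelConcat, List.nil_append, List.append_nil]
      exact (hst.map _).trans (List.prefix_append _ _)
    | cons a l ih =>
      intro n s t r hs hst hn
      obtain ⟨n, rfl⟩ := Nat.exists_eq_succ_of_ne_zero (by omega : n ≠ 0)
      have := ih n s t r hs hst (by simpa using hn)
      simp only [levelConcat, List.cons_append]
      exact ⟨by simp [this.1], (List.prefix_append_right_inj _).2 this.2⟩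
  have mem : ∀ (ξ : Ordinal.{u}) (l : List (List Ordinal.{u})), l ≠ [] →
      (∀ x ∈ l, x ∈ maxElts (Gam ξ)) → levelConcat ξ l.length l ∈ gammaLevel ξ (Gam ξ) l.length := by
    intro ξ l
    induction l with
    | nil => simp
    | cons a l ih =>
      intro _ hl
      rcases eq_or_ne l [] with rfl | hne
      · refine Or.inl ⟨a, (hl a (by simp)).1, by simp [levelConcat]⟩
      · exact Or.inr ⟨a, hl a (by simp), _, ih hne (fun x hx => hl x (by simp [hx])), rfl⟩
  induction h with
  | zero => simp [Gam_zero]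
  | add_one ξ l t' r n s' w hn hmax hw ih =>
    obtain ⟨h1, h2⟩ := cat ξ l n s' t' r ih.1 ih.2.1 (by simp [hn])
    refine ⟨h1, h2, ?_⟩
    rw [Gam_add_one]
    subst hn
    exact Set.mem_iUnion.2 ⟨_, mem ξ _ (by simp) hmax⟩
  | limit ξ ζ s' t' w hξ hζ hw ih =>
    refine ⟨by simpa [shift] using ih.1, ih.2.1.map _, ?_⟩
    rw [Gam_limit hξ]
    simp only [Set.mem_iUnion]
    exact ⟨ζ, hζ, t', ih.2.2, rfl⟩

theorem HasWeight.mem {ξ : Ordinal.{u}} {s t : List Ordinal.{u}} {w : ℝ}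
    (h : HasWeight ξ s t w) : s ∈ Gam ξ :=
  (isBTree_Gam ξ).2 t h.isInit.2.2 s h.isInit.1 h.isInit.2.1

/-- `p_ξ(s, t)` is single valued and does not depend on `t`. -/
theorem HasWeight.unique {ξ : Ordinal.{u}} {s t t' : List Ordinal.{u}} {w w' : ℝ}
    (h : HasWeight ξ s t w) (h' : HasWeight ξ s t' w') : w = w' := by
  induction h generalizing t' w' with
  | zero =>
    generalize hs : ([0] : List Ordinal.{u}) = s at h'
    generalize hξ : (0 : Ordinal.{u}) = η at h'
    cases h' with
    | zero => rfl
    | add_one ξ' => exact absurd hξ.symm (Order.succ_ne_bot ξ')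
    | limit _ _ _ _ _ h => exact absurd hξ.symm h.ne_bot
  | add_one ξ l t₁ r n s₁ w hn hmax hw ih =>
    generalize hξ : ξ + 1 = η at h'
    generalize hs : levelConcat ξ n (l ++ [s₁]) = s at h'
    cases h' with
    | zero => simp at hξ
    | add_one ξ' l' t₁' r' n' s₁' w' hn' hmax' hw' =>
      obtain rfl : ξ = ξ' := by simpa using hξ
      have G : ∀ t ∈ Gam ξ, t ≠ [] ∧ ∀ x ∈ t, x < omega0 ^ ξ := fun t ht =>
        ⟨fun h => (isBTree_Gam ξ).1 (h ▸ ht), Gam_lt ξ t ht⟩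
      have hl : ∀ t ∈ l, t ≠ [] ∧ ∀ x ∈ t, x < omega0 ^ ξ := fun t ht =>
        G t (hmax t (by simp [ht])).1
      have hl' : ∀ t ∈ l', t ≠ [] ∧ ∀ x ∈ t, x < omega0 ^ ξ := fun t ht =>
        G t (hmax' t (by simp [ht])).1
      have gs := G _ hw.mem
      have gs' := G _ hw'.mem
      have hnn : n = n' := by
        obtain ⟨k, rfl⟩ := Nat.exists_eq_succ_of_ne_zero (by simp [hn] : n ≠ 0)
        obtain ⟨k', rfl⟩ := Nat.exists_eq_succ_of_ne_zero (by simp [hn'] : n' ≠ 0)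
        obtain ⟨a, m, ham, ha⟩ : ∃ a m, l ++ [s₁] = a :: m ∧ (a ≠ [] ∧ ∀ x ∈ a, x < omega0 ^ ξ) := by
          rcases l with _ | ⟨a, m⟩
          · exact ⟨_, _, rfl, gs⟩
          · exact ⟨_, _, rfl, hl a (by simp)⟩
        obtain ⟨a', m', ham', ha'⟩ :
            ∃ a m, l' ++ [s₁'] = a :: m ∧ (a ≠ [] ∧ ∀ x ∈ a, x < omega0 ^ ξ) := by
          rcases l' with _ | ⟨a, m⟩
          · exact ⟨_, _, rfl, gs'⟩
          · exact ⟨_, _, rfl, hl' a (by simp)⟩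
        rw [ham, ham'] at hs
        rw [levelConcat_n ha.1 ha'.1 ha.2 ha'.2 hs]
      subst hnn
      obtain rfl := levelConcat_last l l' n s₁ s₁' hl hl' gs.1 gs'.1 gs.2 gs'.2
        (by simp [hn]) (by simp [hn']) hs
      rw [ih hw']
    | limit _ _ _ _ _ h =>
      subst hξ
      have := h.add_one_lt (by simp : ξ < ξ + 1)
      simp at this
  | limit ξ ζ s₁ t₁ w hξ hζ hw ih =>
    generalize hs : shift (omega0 ^ ζ) s₁ = s at h'
    cases h' with
    | zero => exact absurd rfl hξ.ne_bot
    | add_one ξ' =>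
      have := hξ.add_one_lt (by simp : ξ' < ξ' + 1)
      simp at this
    | limit _ ζ' s₁' t₁' w' hξ' hζ' hw' =>
      obtain ⟨a, m, rfl⟩ := List.exists_cons_of_ne_nil hw.isInit.1
      obtain ⟨a', m', rfl⟩ := List.exists_cons_of_ne_nil hw'.isInit.1
      have e : omega0 ^ ζ + a = omega0 ^ ζ' + a' := by
        simp only [shift, List.map_cons, List.cons.injEq] at hs
        exact hs.1
      have hz : ζ = ζ' := by
        rw [← log_opow_add ζ a (Gam_lt _ _ hw.mem a (by simp)), e,
          log_opow_add ζ' a' (Gam_lt _ _ hw'.mem a' (by simp))]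
      subst hz
      rw [← shift_inj hs] at hw'
      exact ih hw'

theorem HasWeight.prob_eq {ξ : Ordinal.{u}} {s t : List Ordinal.{u}} {w : ℝ}
    (h : HasWeight ξ s t w) : prob ξ s = w := by
  have hex : ∃ w t, HasWeight ξ s t w := ⟨w, t, h⟩
  rw [prob, dif_pos hex]
  exact hex.choose_spec.choose_spec.unique h

/-- Every `s ∈ Γ_ξ` has a maximal extension `t`, and `p_ξ(s, t)` is defined. -/
theorem exists_weight (ξ : Ordinal.{u}) : (Gam ξ).Nonempty ∧ ∀ s ∈ Gam ξ,
    ∃ t ∈ maxElts (Gam ξ), ∃ w, HasWeight ξ s t w := by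
  have G0 : ∀ (ξ : Ordinal.{u}), ∀ t ∈ Gam ξ, t ≠ [] ∧ ∀ x ∈ t, x < omega0 ^ ξ := fun ξ t ht =>
        ⟨fun h => (isBTree_Gam ξ).1 (h ▸ ht), Gam_lt ξ t ht⟩
  induction ξ using Ordinal.limitRecOn with
  | zero => 
    rw [Gam_zero]
    refine ⟨by simp, ?_⟩
    rintro s rfl
    exact ⟨[0], ⟨rfl, by rintro s rfl _; rfl⟩, 1, .zero⟩
  | add_one ξ ih =>
    obtain ⟨⟨s0, hs0⟩, ih⟩ := ih
    obtain ⟨m0, hm0, _⟩ := ih s0 hs0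
    refine ⟨⟨s0, by rw [Gam_add_one]; exact Set.mem_iUnion.2 ⟨1, by rwa [gammaLevel_one]⟩⟩, ?_⟩
    have dec : ∀ n, ∀ s ∈ gammaLevel ξ (Gam ξ) n, ∃ l s', (∀ x ∈ l, x ∈ maxElts (Gam ξ)) ∧
        s' ∈ Gam ξ ∧ l.length < n ∧ s = levelConcat ξ n (l ++ [s']) := by
      intro n
      induction n with
      | zero => simp [gammaLevel]
      | succ n ihn =>
        rintro s (⟨t, ht, rfl⟩ | ⟨t, ht, v, hv, rfl⟩)
        · exact ⟨[], t, by simp, ht, by simp, by simp [levelConcat]⟩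
        · obtain ⟨l, s', h1, h2, h3, rfl⟩ := ihn v hv
          exact ⟨t :: l, s', by simpa using ⟨ht, h1⟩, h2, by simpa using h3, rfl⟩
    -- full concatenations are maximal
    have mx : ∀ (l : List (List Ordinal.{u})), l ≠ [] → (∀ x ∈ l, x ∈ maxElts (Gam ξ)) →
        ∀ s ∈ gammaLevel ξ (Gam ξ) l.length, levelConcat ξ l.length l <+: s →
          s = levelConcat ξ l.length l := by
      intro l
      induction l with
      | nil => simp
      | cons a l ihl =>
        intro _ hl s hs hst
        have split : ∀ (b v : List Ordinal.{u}), b ∈ Gam ξ → (∀ x ∈ v, x < omega0 ^ ξ * l.length) →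
          levelConcat ξ (l.length + 1) (a :: l) <+: shift (omega0 ^ ξ * l.length) b ++ v →
            a = b ∧ levelConcat ξ l.length l <+: v := by
          intro b v hb hv h
          simp only [levelConcat] at h
          have lc : ∀ x ∈ levelConcat ξ l.length l, x < omega0 ^ ξ * l.length :=
            levelConcat_lt _ _ (fun t ht => Gam_lt ξ t (hl t (by simp [ht])).1)
          have hab : a <+: b := by
            have := h.filter (fun x => decide (omega0 ^ ξ * l.length ≤ x))
            rw [List.filter_append, List.filter_append, List.filter_eq_self.2,
              (List.filter_eq_nil_iff (l := levelConcat _ _ _)).2, List.filter_eq_self.2,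
              (List.filter_eq_nil_iff (l := v)).2] at this
            · simp only [List.append_nil] at this
              obtain ⟨r, hr, h⟩ := List.prefix_map_iff.1 this
              rw [shift_inj h]; exact hr
            · intro x hx; simpa using hv x hx
            · intro x hx
              obtain ⟨y, hy, rfl⟩ := List.mem_map.1 hx
              simp
            · intro x hx; simpa using lc x hx
            · intro x hx
              obtain ⟨y, hy, rfl⟩ := List.mem_map.1 hx
              simp
          have := (hl a (by simp)).2 b hb hab
          subst this
          exact ⟨rfl, (List.prefix_append_right_inj _).1 h⟩
        rcases hs with ⟨t, ht, rfl⟩ | ⟨t, ht, v, hv, rfl⟩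
        · obtain ⟨rfl, h⟩ := split t [] ht (by simp) (by simpa using hst)
          rw [List.prefix_nil] at h
          simp [levelConcat, h]
        · obtain ⟨rfl, h⟩ := split t v ht.1 (gammaLevel_lt (Gam_lt ξ) _ v hv) hst
          rcases eq_or_ne l [] with rfl | hne
          · simp [gammaLevel] at hv
          · rw [ihl hne (fun x hx => hl x (by simp [hx])) v hv h]; rfl
    rw [Gam_add_one]
    intro s hs
    obtain ⟨n, hn⟩ := Set.mem_iUnion.1 hs
    obtain ⟨l, s', h1, h2, h3, rfl⟩ := dec n s hn
    obtain ⟨t', ht', w, hw⟩ := ih s' h2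
    let L := l ++ t' :: List.replicate (n - l.length - 1) m0
    have hL : L.length = n := by simp [L]; omega
    have hLm : ∀ x ∈ L, x ∈ maxElts (Gam ξ) := by
      intro x hx
      simp only [L, List.mem_append, List.mem_cons, List.mem_replicate] at hx
      rcases hx with hx | rfl | ⟨_, rfl⟩
      · exact h1 x hx
      · exact ht'
      · exact hm0
    have W := HasWeight.add_one ξ l t' (List.replicate (n - l.length - 1) m0) n s' w hL.symm hLm hw
    refine ⟨_, ⟨by rw [← Gam_add_one]; exact W.isInit.2.2, ?_⟩, _, W⟩
    intro s2 hs2 hpre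
    obtain ⟨k, hk⟩ := Set.mem_iUnion.1 hs2
    have hkn : k = n := by
      obtain ⟨l2, s2', h1', h2', h3', rfl⟩ := dec k s2 hk
      obtain ⟨k, rfl⟩ := Nat.exists_eq_succ_of_ne_zero (by omega : k ≠ 0)
      obtain ⟨n, rfl⟩ := Nat.exists_eq_succ_of_ne_zero (by omega : n ≠ 0)
      obtain ⟨a, m, ham, ha⟩ : ∃ a m, L = a :: m ∧ a ∈ Gam ξ := by
        rcases hh : L with _ | ⟨a, m⟩
        · simp [hh] at hL
        · exact ⟨_, _, rfl, (hLm a (by simp [hh])).1⟩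
      obtain ⟨b, m', hbm, hb⟩ : ∃ a m, l2 ++ [s2'] = a :: m ∧ a ∈ Gam ξ := by
        rcases l2 with _ | ⟨a, m⟩
        · exact ⟨_, _, rfl, h2'⟩
        · exact ⟨_, _, rfl, (h1' a (by simp)).1⟩
      change levelConcat ξ (n+1) L <+: _ at hpre
      rw [ham, hbm] at hpre
      have ga := G0 ξ a ha
      have gb := G0 ξ b hb
      obtain ⟨x, a, rfl⟩ := List.exists_cons_of_ne_nil ga.1
      obtain ⟨y, b, rfl⟩ := List.exists_cons_of_ne_nil gb.1
      simp only [levelConcat, shift, List.map_cons, List.cons_append, List.cons_prefix_cons] at hpre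
      have e := congrArg (· / omega0 ^ ξ) hpre.1
      have := (opow_pos ξ omega0_pos).ne'
      simp only [mul_add_div _ this, div_eq_zero_of_lt (ga.2 x (by simp)),
        div_eq_zero_of_lt (gb.2 y (by simp)), add_zero] at e
      have : n = k := by exact_mod_cast e
      simp [this]
    subst hkn
    have := mx L (by simp [L]) hLm s2 (hL ▸ hk) (by rw [hL]; exact hpre)
    rw [this, hL]
  | limit ξ hξ ih =>
    obtain ⟨⟨s0, hs0⟩, _⟩ := ih _ (hξ.add_one_lt hξ.bot_lt)
    refine ⟨⟨shift (omega0 ^ (0:Ordinal)) s0, by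
      rw [Gam_limit hξ]; simp only [Set.mem_iUnion]
      exact ⟨0, hξ.bot_lt, s0, hs0, rfl⟩⟩, ?_⟩
    intro s hs
    rw [Gam_limit hξ] at hs
    simp only [Set.mem_iUnion] at hs
    obtain ⟨ζ, hζ, s', hs', rfl⟩ := hs
    obtain ⟨t, ht, w, hw⟩ := (ih _ (hξ.add_one_lt hζ)).2 s' hs'
    have W := HasWeight.limit ξ ζ s' t w hξ hζ hw
    refine ⟨_, ⟨W.isInit.2.2, ?_⟩, w, W⟩
    intro s2 hs2 hp
    rw [Gam_limit hξ] at hs2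
    simp only [Set.mem_iUnion] at hs2
    obtain ⟨η, hη, s2, hs2, rfl⟩ := hs2
    have gt := G0 _ t ht.1
    have gs := G0 _ s2 hs2
    obtain ⟨a, m, rfl⟩ := List.exists_cons_of_ne_nil gt.1
    obtain ⟨b, m', rfl⟩ := List.exists_cons_of_ne_nil gs.1
    have e : ζ = η := by
      simp only [shift, List.map_cons, List.cons_prefix_cons] at hp
      rw [← log_opow_add ζ a (gt.2 a (by simp)), hp.1, log_opow_add η b (gs.2 b (by simp))]
    subst e
    obtain ⟨r, hr, h⟩ := List.prefix_map_iff.1 hp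
    rw [← shift_inj h] at hr
    rw [ht.2 _ hs2 hr]

end WellDefined

/-- `T D = {(t, σ) : t ∈ T, σ a sequence in D with |σ| = |t|}`, as sequences of pairs. -/
def treeProd {Λ : Type*} (T : Set (List Λ)) (D : Type*) : Set (List (Λ × D)) :=
  {τ | τ.map Prod.fst ∈ T}

/-- `Ω_ξ = Γ_ξ D`. -/
def Omg (ξ : Ordinal.{u}) (D : Type v) : Set (List (Ordinal.{u} × D)) :=
  treeProd (Gam ξ) D

theorem isBTree_Omg (ξ : Ordinal.{u}) (D : Type v) : IsBTree (Omg ξ D) := by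
  refine ⟨fun h => (isBTree_Gam ξ).1 h, fun t ht s hs hst => ?_⟩
  exact (isBTree_Gam ξ).2 _ ht _ (by simpa using hs) (hst.map _)

/-- An extended pruning `(θ, e) : S₁ → S₂` between subsets of trees `T₁ D`, `T₂ D`: a map `θ` that
is monotone for proper initial segments and does not decrease the last `D`-coordinate,
with a map `e` of the maximal members such that `θ(τ) ⪯ e(τ)`. -/
structure ExtPruning {Λ₁ Λ₂ : Type*} {D : Type*} [Preorder D]
    (S₁ : Set (List (Λ₁ × D))) (S₂ : Set (List (Λ₂ × D))) where
  θ : S₁ → S₂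
  e : maxElts S₁ → maxElts S₂
  monotone : ∀ τ τ' : S₁, τ.1 <+: τ'.1 → τ.1 ≠ τ'.1 →
    (θ τ).1 <+: (θ τ').1 ∧ (θ τ).1 ≠ (θ τ').1
  le_last : ∀ τ : S₁, ∀ x ∈ τ.1.getLast?, ∀ y ∈ (θ τ).1.getLast?, x.2 ≤ y.2
  prefix_e : ∀ τ : maxElts S₁, (θ ⟨τ.1, τ.2.1⟩).1 <+: (e τ).1

/-- The pair `(θ(τ'), e(τ)) ∈ Π S₂` for `(τ', τ) ∈ Π S₁`. -/
def ExtPruning.mapPair {Λ₁ Λ₂ : Type*} {D : Type*} [Preorder D]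
    {S₁ : Set (List (Λ₁ × D))} {S₂ : Set (List (Λ₂ × D))} (P : ExtPruning S₁ S₂)
    (q : branchPairs S₁) : branchPairs S₂ :=
  ⟨((P.θ ⟨q.1.1, q.2.1⟩).1, (P.e ⟨q.1.2, q.2.2.1⟩).1), (P.θ _).2, (P.e _).2, by
    refine List.IsPrefix.trans ?_ (P.prefix_e ⟨q.1.2, q.2.2.1⟩)
    by_cases h : q.1.1 = q.1.2
    · simp only [h]; exact List.prefix_rfl
    · exact (P.monotone ⟨q.1.1, q.2.1⟩ ⟨q.1.2, q.2.2.1.1⟩ q.2.2.2 h).1⟩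

/-- The pair `(τ|_{i+1}, τ) ∈ Π Ω_ξ` for `τ ∈ MAX(Ω_ξ)` and `i < |τ|`. -/
def initPair {ξ : Ordinal.{u}} {D : Type v} (τ : maxElts (Omg ξ D)) (i : Fin τ.1.length) :
    branchPairs (Omg ξ D) :=
  ⟨(τ.1.take (i + 1), τ.1),
    (isBTree_Omg ξ D).2 τ.1 τ.2.1 _
      (by
        have := i.2
        intro h
        rcases List.take_eq_nil_iff.1 h with h | h
        · simp at h
        · simp [h] at this)
      (List.take_prefix _ _),
    τ.2, List.take_prefix _ _⟩

/-- The weighted branch average `∑_{∅ ≺ τ' ⪯ τ} ℙ_ξ(τ') g(τ', τ)`, where `ℙ_ξ(t, σ) = ℙ_ξ(t)`;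
the nonempty initial segments of `τ` are its restrictions to the lengths `1, …, |τ|`. -/
noncomputable def branchAvg {ξ : Ordinal.{u}} {D : Type v} (g : branchPairs (Omg ξ D) → ℝ)
    (τ : maxElts (Omg ξ D)) : ℝ :=
  ∑ i : Fin τ.1.length, prob ξ ((τ.1.take (i + 1)).map Prod.fst) * g (initPair τ i)

/-- `g` is `ε`-small. -/
def IsSmall {ξ : Ordinal.{u}} {D : Type v} [Preorder D] (g : branchPairs (Omg ξ D) → ℝ)
    (ε : ℝ) : Prop :=
  ∃ P : ExtPruning (Omg ξ D) (Omg ξ D), ∀ τ : maxElts (Omg ξ D), branchAvg g (P.e τ) < ε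

/-- `g` is `ε`-large. -/
def IsLarge {ξ : Ordinal.{u}} {D : Type v} [Preorder D] (g : branchPairs (Omg ξ D) → ℝ)
    (ε : ℝ) : Prop :=
  ∀ δ : ℝ, 0 < δ → ∃ P : ExtPruning (Omg ξ D) (Omg ξ D),
    ∀ q : branchPairs (Omg ξ D), ε - δ ≤ g (P.mapPair q)

end OrdTree

/-! ### Prunings as total maps, their marks and their composition. -/

namespace OrdTree

/-! Both parts follow from a dichotomy (`Dichotomy`, proved in `dichotomy` by induction on `ξ`) for
bounded `F s b` on `Ω_ξ`: given `c` and `δ > 0`, either some pruning gives `F ≥ c - δ` at all pairs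
`(θ(s), e(τ))`, or some pruning makes the weighted average along every `e(τ)` less than `c`. A
function that is not `ε`-small must take the first alternative for every `δ`, so it is `ε`-large;
and a function whose averages are all at least `ε` cannot be `ε`-small.

For `ξ = 0` the branches are points of `D`, and the function is either eventually at least `c` or
frequently below `c`. Otherwise `Ω_ξ` splits into mutually incomparable components, each embedding
in the later ones, so a pruning need only be found on cofinally many components
(`IsComponents.prunes_of_cofinal`). At a limit this and the induction hypothesis suffice.

At `ξ + 1` the components are the `n`-fold concatenations `Ω_{ξ,n}` of `Ω_ξ`, and the average along
a branch is the mean of its `n` stage averages. The dichotomy on `Ω_ξ`, applied to each stage, flags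
it as large or small (`Dichotomy.exists_flags`). With few large stages and `n` big, the whole
average is below `c`. With many, a long concatenation is pruned into the large stages, passing over
the small ones (`Strat.prunes_levelOmg`).

The obstacle is that `F s b` with `s` in an early stage depends on all later stages of `b`. The
dichotomy for indicator functions is a Ramsey property: every finite colouring of `MAX(Ω_ξ)` becomes
constant along a pruning. Hence the later prunings can be refined until the rounded values of `F` at
an early stage depend only on the branch of that stage (`Strat.color`), and the dichotomy applies to
these. -/

/-- Extended prunings as pairs of total maps. -/
structure PruneMap {Λ : Type*} {D : Type*} [Preorder D] (S₁ S₂ : Set (List (Λ × D))) where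
  θ : List (Λ × D) → List (Λ × D)
  e : List (Λ × D) → List (Λ × D)
  map_mem : ∀ τ ∈ S₁, θ τ ∈ S₂
  map_max : ∀ τ ∈ maxElts S₁, e τ ∈ maxElts S₂
  mono : ∀ τ ∈ S₁, ∀ τ' ∈ S₁, τ <+: τ' → τ ≠ τ' → θ τ <+: θ τ' ∧ θ τ ≠ θ τ'
  le_last : ∀ τ ∈ S₁, ∀ x ∈ τ.getLast?, ∃ y ∈ (θ τ).getLast?, x.2 ≤ y.2
  prefix_e : ∀ τ ∈ maxElts S₁, θ τ <+: e τ

namespace PruneMap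

variable {Λ : Type*} {D : Type*} [Preorder D] {S₁ S₂ S₃ : Set (List (Λ × D))}

theorem mono_le (P : PruneMap S₁ S₂) {τ τ' : List (Λ × D)} (h : τ ∈ S₁) (h' : τ' ∈ S₁)
    (hp : τ <+: τ') : P.θ τ <+: P.θ τ' := by
  by_cases he : τ = τ'
  · rw [he]
  · exact (P.mono τ h τ' h' hp he).1

theorem prefix_max (P : PruneMap S₁ S₂) {τ τ' : List (Λ × D)} (h : τ ∈ S₁) (h' : τ' ∈ maxElts S₁)
    (hp : τ <+: τ') : P.θ τ <+: P.e τ' :=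
  (P.mono_le h h'.1 hp).trans (P.prefix_e τ' h')

/-- The images under `θ` of the initial segments of `τ`. -/
def marks (P : PruneMap S₁ S₂) (τ : List (Λ × D)) : Set (List (Λ × D)) :=
  {x | ∃ s ∈ S₁, s <+: τ ∧ P.θ s = x}

theorem marks_spec (P : PruneMap S₁ S₂) {τ : List (Λ × D)} (h : τ ∈ maxElts S₁) :
    ∀ x ∈ P.marks τ, x ∈ S₂ ∧ x <+: P.e τ := by
  rintro x ⟨s, hs, hp, rfl⟩
  exact ⟨P.map_mem s hs, P.prefix_max hs h hp⟩

/-- Composition of prunings. -/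
def comp (Q : PruneMap S₂ S₃) (P : PruneMap S₁ S₂) : PruneMap S₁ S₃ where
  θ := Q.θ ∘ P.θ
  e := Q.e ∘ P.e
  map_mem τ h := Q.map_mem _ (P.map_mem _ h)
  map_max τ h := Q.map_max _ (P.map_max _ h)
  mono τ h τ' h' hp hne :=
    have := P.mono τ h τ' h' hp hne
    Q.mono _ (P.map_mem _ h) _ (P.map_mem _ h') this.1 this.2
  le_last τ h x hx := by
    obtain ⟨y, hy, hxy⟩ := P.le_last τ h x hx
    obtain ⟨z, hz, hyz⟩ := Q.le_last _ (P.map_mem _ h) y hy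
    exact ⟨z, hz, hxy.trans hyz⟩
  prefix_e τ h := Q.prefix_max (P.map_mem _ h.1) (P.map_max _ h) (P.prefix_e τ h)

theorem marks_comp (Q : PruneMap S₂ S₃) (P : PruneMap S₁ S₂) (τ : List (Λ × D)) :
    (Q.comp P).marks τ = Q.θ '' P.marks τ := by
  ext x
  constructor
  · rintro ⟨s, hs, hp, rfl⟩
    exact ⟨P.θ s, ⟨s, hs, hp, rfl⟩, rfl⟩
  · rintro ⟨_, ⟨s, hs, hp, rfl⟩, rfl⟩
    exact ⟨s, hs, hp, rfl⟩

/-- Since `P.θ s ⪯ P.e τ`, pruning the source first only loses marks. This is why conditions on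
outcomes are required to pass to smaller sets of marks. -/
theorem marks_comp_subset (Q : PruneMap S₂ S₃) (P : PruneMap S₁ S₂) {τ : List (Λ × D)}
    (h : τ ∈ maxElts S₁) : (Q.comp P).marks τ ⊆ Q.marks (P.e τ) := by
  rw [marks_comp]
  rintro _ ⟨x, hx, rfl⟩
  exact ⟨x, (P.marks_spec h x hx).1, (P.marks_spec h x hx).2, rfl⟩

/-- The identity pruning. -/
def refl (S : Set (List (Λ × D))) : PruneMap S S where
  θ := id
  e := id
  map_mem _ h := h
  map_max _ h := h
  mono _ _ _ _ hp hne := ⟨hp, hne⟩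
  le_last _ _ x hx := ⟨x, hx, le_rfl⟩
  prefix_e _ _ := List.prefix_rfl

/-- The extended pruning defined by a pair of total maps. -/
def toExt (P : PruneMap S₁ S₂) : ExtPruning S₁ S₂ where
  θ τ := ⟨P.θ τ.1, P.map_mem _ τ.2⟩
  e τ := ⟨P.e τ.1, P.map_max _ τ.2⟩
  monotone τ τ' hp hne := P.mono _ τ.2 _ τ'.2 hp hne
  le_last τ x hx y hy := by
    obtain ⟨z, hz, hxz⟩ := P.le_last _ τ.2 x hx
    rw [Option.mem_def] at hy hz
    rw [hy, Option.some_inj] at hz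
    exact hz ▸ hxz
  prefix_e τ := P.prefix_e _ τ.2

end PruneMap

/-! ### Prunings with controlled outcomes, and incomparable components. -/

section Prunes

variable {Λ : Type*} {D : Type*} [Preorder D] {S₁ S₂ S₃ S : Set (List (Λ × D))}
  {Ψ Ψ' : List (Λ × D) → Set (List (Λ × D)) → Prop}

/-- There is a pruning from `S₁` to `S₂` along which all outcomes satisfy `Ψ`. -/
def Prunes (S₁ S₂ : Set (List (Λ × D))) (Ψ : List (Λ × D) → Set (List (Λ × D)) → Prop) : Prop :=
  ∃ P : PruneMap S₁ S₂, ∀ τ ∈ maxElts S₁, Ψ (P.e τ) (P.marks τ)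

/-- `Ψ` is inherited by smaller sets of marks. -/
def MarkAntitone (Ψ : List (Λ × D) → Set (List (Λ × D)) → Prop) : Prop :=
  ∀ b M N, M ⊆ N → Ψ b N → Ψ b M

theorem Prunes.mono (h : Prunes S₁ S₂ Ψ)
    (hΨ : ∀ b ∈ maxElts S₂, ∀ M, (∀ x ∈ M, x ∈ S₂ ∧ x <+: b) → Ψ b M → Ψ' b M) :
    Prunes S₁ S₂ Ψ' := by
  obtain ⟨P, hP⟩ := h
  exact ⟨P, fun τ hτ => hΨ _ (P.map_max τ hτ) _ (P.marks_spec hτ) (hP τ hτ)⟩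

theorem Prunes.precomp (hΨ : MarkAntitone Ψ) (h : Prunes S₂ S₃ Ψ) (P : PruneMap S₁ S₂) :
    Prunes S₁ S₃ Ψ := by
  obtain ⟨Q, hQ⟩ := h
  exact ⟨Q.comp P, fun τ hτ => hΨ _ _ _ (Q.marks_comp_subset P hτ) (hQ _ (P.map_max τ hτ))⟩

theorem Prunes.postcomp (Q : PruneMap S₂ S₃)
    (h : Prunes S₁ S₂ (fun b M => Ψ (Q.e b) (Q.θ '' M))) : Prunes S₁ S₃ Ψ := by
  obtain ⟨P, hP⟩ := h
  exact ⟨Q.comp P, fun τ hτ => by rw [PruneMap.marks_comp]; exact hP τ hτ⟩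

/-- `S` is the union of the sets `A i`, and members of different `A i` are incomparable. -/
structure IsComponents {ι : Type*} (A : ι → Set (List (Λ × D))) (S : Set (List (Λ × D))) :
    Prop where
  subset : ∀ i, A i ⊆ S
  cover : ∀ τ ∈ S, ∃ i, τ ∈ A i
  sep : ∀ i j, ∀ τ ∈ A i, ∀ τ' ∈ A j, τ <+: τ' → i = j

/-- The inclusion of a component. -/
def IsComponents.incl {ι : Type*} {A : ι → Set (List (Λ × D))} (h : IsComponents A S) (i : ι) :
    PruneMap (A i) S where
  θ := id
  e := id
  map_mem _ hτ := h.subset i hτ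
  map_max τ hτ := by
    refine ⟨h.subset i hτ.1, fun s hs hp => ?_⟩
    obtain ⟨j, hj⟩ := h.cover s hs
    obtain rfl := h.sep i j τ hτ.1 s hj hp
    exact hτ.2 s hj hp
  mono _ _ _ _ hp hne := ⟨hp, hne⟩
  le_last _ _ x hx := ⟨x, hx, le_rfl⟩
  prefix_e _ _ := List.prefix_rfl

theorem IsComponents.prunes_incl {ι : Type*} {A : ι → Set (List (Λ × D))} (h : IsComponents A S)
    (i : ι) (hp : Prunes S₁ (A i) Ψ) : Prunes S₁ S Ψ :=
  Prunes.postcomp (h.incl i) (by simpa [IsComponents.incl] using hp)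

/-- Comparable sequences share a component, so prunings chosen independently on the components glue
together; all marks of a branch come from its own component. -/
theorem IsComponents.prunes {ι : Type*} {A : ι → Set (List (Λ × D))} (h : IsComponents A S₁)
    (hp : ∀ i, Prunes (A i) S₂ Ψ) : Prunes S₁ S₂ Ψ := by
  classical
  choose P hP using hp
  let idx : ∀ τ ∈ S₁, ι := fun τ hτ => (h.cover τ hτ).choose
  have idx_mem : ∀ τ hτ, τ ∈ A (idx τ hτ) := fun τ hτ => (h.cover τ hτ).choose_spec
  have idx_eq : ∀ τ hτ i, τ ∈ A i → idx τ hτ = i := fun τ hτ i hi =>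
    h.sep _ _ τ (idx_mem τ hτ) τ hi List.prefix_rfl
  let θ : List (Λ × D) → List (Λ × D) := fun τ =>
    if hτ : τ ∈ S₁ then (P (idx τ hτ)).θ τ else τ
  let e : List (Λ × D) → List (Λ × D) := fun τ =>
    if hτ : τ ∈ S₁ then (P (idx τ hτ)).e τ else τ
  have θ_eq : ∀ i, ∀ τ ∈ A i, θ τ = (P i).θ τ := fun i τ hi => by
    have hτ := h.subset i hi
    simp only [θ, dif_pos hτ]
    rw [idx_eq τ hτ i hi]
  have e_eq : ∀ i, ∀ τ ∈ A i, e τ = (P i).e τ := fun i τ hi => by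
    have hτ := h.subset i hi
    simp only [e, dif_pos hτ]
    rw [idx_eq τ hτ i hi]
  have max_comp : ∀ i, ∀ τ ∈ A i, τ ∈ maxElts S₁ → τ ∈ maxElts (A i) := fun i τ hi hτ =>
    ⟨hi, fun s hs hp => hτ.2 s (h.subset i hs) hp⟩
  refine ⟨⟨θ, e, ?_, ?_, ?_, ?_, ?_⟩, ?_⟩
  · intro τ hτ
    obtain ⟨i, hi⟩ := h.cover τ hτ
    rw [θ_eq i τ hi]
    exact (P i).map_mem τ hi
  · intro τ hτ
    obtain ⟨i, hi⟩ := h.cover τ hτ.1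
    rw [e_eq i τ hi]
    exact (P i).map_max τ (max_comp i τ hi hτ)
  · intro τ hτ τ' hτ' hp hne
    obtain ⟨i, hi⟩ := h.cover τ hτ
    obtain ⟨j, hj⟩ := h.cover τ' hτ'
    obtain rfl := h.sep i j τ hi τ' hj hp
    rw [θ_eq i τ hi, θ_eq i τ' hj]
    exact (P i).mono τ hi τ' hj hp hne
  · intro τ hτ
    obtain ⟨i, hi⟩ := h.cover τ hτ
    rw [θ_eq i τ hi]
    exact (P i).le_last τ hi
  · intro τ hτ
    obtain ⟨i, hi⟩ := h.cover τ hτ.1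
    rw [e_eq i τ hi, θ_eq i τ hi]
    exact (P i).prefix_e τ (max_comp i τ hi hτ)
  · intro τ hτ
    obtain ⟨i, hi⟩ := h.cover τ hτ.1
    have := hP i τ (max_comp i τ hi hτ)
    convert this using 1
    · exact e_eq i τ hi
    · ext x
      constructor
      · rintro ⟨s, hs, hp, rfl⟩
        obtain ⟨j, hj⟩ := h.cover s hs
        obtain rfl := h.sep j i s hj τ hi hp
        exact ⟨s, hj, hp, (θ_eq j s hj).symm⟩
      · rintro ⟨s, hs, hp, rfl⟩
        exact ⟨s, h.subset i hs, hp, θ_eq i s hs⟩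

/-- A component without a good pruning borrows one from a later component, into which it embeds. -/
theorem IsComponents.prunes_of_cofinal {ι : Type*} [LE ι] {A : ι → Set (List (Λ × D))}
    (h : IsComponents A S₁) (emb : ∀ i j, i ≤ j → Nonempty (PruneMap (A i) (A j)))
    (hΨ : MarkAntitone Ψ) (hp : ∀ i, ∃ j, i ≤ j ∧ Prunes (A j) S₂ Ψ) : Prunes S₁ S₂ Ψ := by
  refine h.prunes fun i => ?_
  obtain ⟨j, hij, hj⟩ := hp i
  obtain ⟨P⟩ := emb i j hij
  exact hj.precomp hΨ P

end Prunes

/-! ### Shifting ordinals, and splitting a sequence at an ordinal. -/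

section Shift

open Ordinal

variable {D : Type v}

/-- `a + τ`, on the ordinal coordinates. -/
noncomputable def shiftD (a : Ordinal.{u}) (τ : List (Ordinal.{u} × D)) : List (Ordinal.{u} × D) :=
  τ.map (Prod.map (a + ·) id)

open Classical in
/-- The part of `τ` with ordinals at least `a`, shifted back. -/
noncomputable def headPart (a : Ordinal.{u}) (τ : List (Ordinal.{u} × D)) :
    List (Ordinal.{u} × D) :=
  (τ.filter (fun x => decide (a ≤ x.1))).map (Prod.map (· - a) id)

open Classical in
/-- The part of `τ` with ordinals below `a`. -/
noncomputable def tailPart (a : Ordinal.{u}) (τ : List (Ordinal.{u} × D)) :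
    List (Ordinal.{u} × D) :=
  τ.filter (fun x => !decide (a ≤ x.1))

theorem headPart_append (a : Ordinal.{u}) (s w : List (Ordinal.{u} × D)) (hw : ∀ x ∈ w, x.1 < a) :
    headPart a (shiftD a s ++ w) = s := by
  classical
  rw [headPart, List.filter_append, List.filter_eq_self.2, List.filter_eq_nil_iff.2,
    List.append_nil, shiftD, List.map_map]
  · conv_rhs => rw [← List.map_id s]
    congr 1
    funext x
    simp [Prod.map]
  · intro x hx; simpa using hw x hx
  · intro x hx
    obtain ⟨y, hy, rfl⟩ := List.mem_map.1 hx
    simp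

theorem tailPart_append (a : Ordinal.{u}) (s w : List (Ordinal.{u} × D)) (hw : ∀ x ∈ w, x.1 < a) :
    tailPart a (shiftD a s ++ w) = w := by
  classical
  rw [tailPart, List.filter_append, List.filter_eq_nil_iff.2, List.nil_append,
    List.filter_eq_self.2]
  · intro x hx; simpa using hw x hx
  · intro x hx
    obtain ⟨y, hy, rfl⟩ := List.mem_map.1 hx
    simp

theorem headPart_shiftD (a : Ordinal.{u}) (s : List (Ordinal.{u} × D)) :
    headPart a (shiftD a s) = s := by
  simpa using headPart_append a s [] (by simp)

theorem tailPart_shiftD (a : Ordinal.{u}) (s : List (Ordinal.{u} × D)) :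
    tailPart a (shiftD a s) = [] := by
  simpa using tailPart_append a s [] (by simp)

theorem headPart_prefix (a : Ordinal.{u}) {s t : List (Ordinal.{u} × D)} (h : s <+: t) :
    headPart a s <+: headPart a t := (h.filter _).map _

theorem tailPart_prefix (a : Ordinal.{u}) {s t : List (Ordinal.{u} × D)} (h : s <+: t) :
    tailPart a s <+: tailPart a t := h.filter _

theorem shiftD_prefix_iff (a : Ordinal.{u}) {s t : List (Ordinal.{u} × D)} :
    shiftD a s <+: shiftD a t ↔ s <+: t :=
  ⟨fun h => by simpa [headPart_shiftD] using headPart_prefix a h, fun h => h.map _⟩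

theorem shiftD_injective (a : Ordinal.{u}) :
    Function.Injective (shiftD a : List (Ordinal.{u} × D) → _) :=
  Function.LeftInverse.injective (headPart_shiftD a)

theorem mem_getLast?_shiftD {a : Ordinal.{u}} {s : List (Ordinal.{u} × D)}
    {y : Ordinal.{u} × D} : y ∈ (shiftD a s).getLast? ↔ ∃ x ∈ s.getLast?, (a + x.1, x.2) = y := by
  simp [shiftD, List.getLast?_map, Prod.map]

theorem shiftD_map_fst (a : Ordinal.{u}) (s : List (Ordinal.{u} × D)) :
    (shiftD a s).map Prod.fst = shift a (s.map Prod.fst) := by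
  simp [shiftD, shift]

theorem maxElts_image_shiftD (a : Ordinal.{u}) (S : Set (List (Ordinal.{u} × D))) :
    maxElts (shiftD a '' S) = shiftD a '' maxElts S := by
  ext τ
  constructor
  · rintro ⟨⟨s, hs, rfl⟩, h⟩
    exact ⟨s, ⟨hs, fun t ht hp => shiftD_injective a
      (h _ ⟨t, ht, rfl⟩ ((shiftD_prefix_iff a).2 hp))⟩, rfl⟩
  · rintro ⟨s, ⟨hs, h⟩, rfl⟩
    refine ⟨⟨s, hs, rfl⟩, ?_⟩
    rintro _ ⟨t, ht, rfl⟩ hp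
    rw [h t ht ((shiftD_prefix_iff a).1 hp)]

variable [Preorder D]

/-- The isomorphism of a tree with its shift. -/
noncomputable def shiftMap (a : Ordinal.{u}) (S : Set (List (Ordinal.{u} × D))) :
    PruneMap S (shiftD a '' S) where
  θ := shiftD a
  e := shiftD a
  map_mem τ h := ⟨τ, h, rfl⟩
  map_max τ h := by rw [maxElts_image_shiftD]; exact ⟨τ, h, rfl⟩
  mono τ _ τ' _ hp hne := ⟨(shiftD_prefix_iff a).2 hp, fun h => hne (shiftD_injective a h)⟩
  le_last τ _ x hx := ⟨_, mem_getLast?_shiftD.2 ⟨x, hx, rfl⟩, le_rfl⟩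
  prefix_e _ _ := List.prefix_rfl

/-- The isomorphism of a shifted tree with the original. -/
noncomputable def unshiftMap (a : Ordinal.{u}) (S : Set (List (Ordinal.{u} × D))) :
    PruneMap (shiftD a '' S) S where
  θ := headPart a
  e := headPart a
  map_mem := by
    rintro _ ⟨τ, h, rfl⟩
    rwa [headPart_shiftD]
  map_max := by
    rw [maxElts_image_shiftD]
    rintro _ ⟨τ, h, rfl⟩
    rwa [headPart_shiftD]
  mono := by
    rintro _ ⟨τ, h, rfl⟩ _ ⟨τ', h', rfl⟩ hp hne
    rw [headPart_shiftD, headPart_shiftD]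
    exact ⟨(shiftD_prefix_iff a).1 hp, fun h => hne (by rw [h])⟩
  le_last := by
    rintro _ ⟨τ, h, rfl⟩ x hx
    obtain ⟨y, hy, rfl⟩ := mem_getLast?_shiftD.1 hx
    exact ⟨y, by rwa [headPart_shiftD], le_rfl⟩
  prefix_e _ _ := List.prefix_rfl

end Shift

/-! ### Prunings of concatenated trees. -/

section Concat

variable {D : Type v}

/-- `(a + A) ∪ {(a + t) ⌢ w : t ∈ MAX(A), w ∈ B}`. -/
def concatTree (a : Ordinal.{u}) (A B : Set (List (Ordinal.{u} × D))) :
    Set (List (Ordinal.{u} × D)) :=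
  shiftD a '' A ∪ {r | ∃ t ∈ maxElts A, ∃ w ∈ B, r = shiftD a t ++ w}

/-- `B` consists of nonempty sequences with ordinals below `a`. -/
structure IsBelow (a : Ordinal.{u}) (B : Set (List (Ordinal.{u} × D))) : Prop where
  lt : ∀ w ∈ B, ∀ x ∈ w, x.1 < a
  ne_nil : ∀ w ∈ B, w ≠ []

variable {a a' : Ordinal.{u}} {A A' B B' : Set (List (Ordinal.{u} × D))}

theorem mem_maxElts_concatTree (hB : IsBelow a B) {t w : List (Ordinal.{u} × D)}
    (ht : t ∈ maxElts A) (hw : w ∈ maxElts B) : shiftD a t ++ w ∈ maxElts (concatTree a A B) := by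
  refine ⟨Or.inr ⟨t, ht, w, hw.1, rfl⟩, ?_⟩
  rintro _ (⟨s, hs, rfl⟩ | ⟨t', ht', w', hw', rfl⟩) hp
  · have := tailPart_prefix a hp
    rw [tailPart_append a t w (hB.lt w hw.1), tailPart_shiftD, List.prefix_nil] at this
    exact absurd this (hB.ne_nil w hw.1)
  · have h1 := headPart_prefix a hp
    have h2 := tailPart_prefix a hp
    rw [headPart_append _ _ _ (hB.lt w hw.1), headPart_append _ _ _ (hB.lt w' hw')] at h1
    rw [tailPart_append _ _ _ (hB.lt w hw.1), tailPart_append _ _ _ (hB.lt w' hw')] at h2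
    rw [ht.2 t' ht'.1 h1, hw.2 w' hw' h2]

theorem exists_of_mem_maxElts_concatTree (hB : IsBelow a B) (hne : B.Nonempty)
    {τ : List (Ordinal.{u} × D)} (h : τ ∈ maxElts (concatTree a A B)) :
    ∃ t ∈ maxElts A, ∃ w ∈ maxElts B, τ = shiftD a t ++ w := by
  obtain ⟨⟨s, hs, rfl⟩ | ⟨t, ht, w, hw, rfl⟩, hmax⟩ := h
  · exfalso
    obtain ⟨w, hw⟩ := hne
    have hs' : s ∈ maxElts A := ⟨hs, fun s' hs' hp => shiftD_injective a
      (hmax _ (Or.inl ⟨s', hs', rfl⟩) ((shiftD_prefix_iff a).2 hp))⟩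
    have := hmax _ (Or.inr ⟨s, hs', w, hw, rfl⟩) (List.prefix_append _ _)
    exact hB.ne_nil w hw (by simpa using this)
  · refine ⟨t, ht, w, ⟨hw, fun w' hw' hp => ?_⟩, rfl⟩
    exact List.append_cancel_left
      (hmax _ (Or.inr ⟨t, ht, w', hw', rfl⟩) ((List.prefix_append_right_inj _).2 hp))

variable [Preorder D] {Ψ : List (Ordinal.{u} × D) → Set (List (Ordinal.{u} × D)) → Prop}

/-- The second pruning may depend on the maximal branch `t` of the first: a sequence `(a + t) ⌢ w`
goes to `(a' + P.e t) ⌢ R_t(w)`. Monotonicity across the junction is `θ(s) ⪯ e(t)`, and it is strict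
because `B'` has no empty sequence. -/
theorem Prunes.concat (hB : IsBelow a B) (hB' : IsBelow a' B') (hne : B.Nonempty)
    (hA : (maxElts A).Nonempty) (hΨ : MarkAntitone Ψ)
    (h : Prunes A A' (fun b M => Prunes B B' (fun w N =>
      Ψ (shiftD a' b ++ w) (shiftD a' '' M ∪ (shiftD a' b ++ ·) '' N)))) :
    Prunes (concatTree a A B) (concatTree a' A' B') Ψ := by
  classical
  obtain ⟨P, hP⟩ := h
  have hex : ∀ t, ∃ R : PruneMap B B', t ∈ maxElts A → ∀ w ∈ maxElts B,
      Ψ (shiftD a' (P.e t) ++ R.e w)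
        (shiftD a' '' P.marks t ∪ (shiftD a' (P.e t) ++ ·) '' R.marks w) := by
    obtain ⟨t₀, ht₀⟩ := hA
    intro t
    by_cases ht : t ∈ maxElts A
    · obtain ⟨R, hR⟩ := hP t ht
      exact ⟨R, fun _ => hR⟩
    -- Off the maximal branches any pruning serves as a filler; a maximal element of `A` provides
    -- one.
    · obtain ⟨R, -⟩ := hP t₀ ht₀
      exact ⟨R, fun h => absurd h ht⟩
  choose R hR using hex
  let θ : List (Ordinal.{u} × D) → List (Ordinal.{u} × D) := fun τ =>
    if tailPart a τ = [] then shiftD a' (P.θ (headPart a τ))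
    else shiftD a' (P.e (headPart a τ)) ++ (R (headPart a τ)).θ (tailPart a τ)
  let e : List (Ordinal.{u} × D) → List (Ordinal.{u} × D) := fun τ =>
    shiftD a' (P.e (headPart a τ)) ++ (R (headPart a τ)).e (tailPart a τ)
  have θ_head : ∀ s, θ (shiftD a s) = shiftD a' (P.θ s) := fun s => by
    simp only [θ, tailPart_shiftD, headPart_shiftD, if_true]
  have θ_tail : ∀ t, ∀ w ∈ B, θ (shiftD a t ++ w) = shiftD a' (P.e t) ++ (R t).θ w := by
    intro t w hw
    simp only [θ, tailPart_append a t w (hB.lt w hw), headPart_append a t w (hB.lt w hw),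
      if_neg (hB.ne_nil w hw)]
  have e_tail : ∀ t, ∀ w ∈ B, e (shiftD a t ++ w) = shiftD a' (P.e t) ++ (R t).e w := by
    intro t w hw
    simp only [e, tailPart_append a t w (hB.lt w hw), headPart_append a t w (hB.lt w hw)]
  have cmp : ∀ t, t ∈ maxElts A → ∀ w ∈ B, ∀ t' ∈ A, ∀ w', (∀ x ∈ w', x.1 < a) →
      shiftD a t ++ w <+: shiftD a t' ++ w' → t' = t ∧ w <+: w' := by
    intro t ht w hw t' ht' w' hw' hp
    have h1 := headPart_prefix a hp
    have h2 := tailPart_prefix a hp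
    rw [headPart_append _ _ _ (hB.lt w hw), headPart_append _ _ _ hw'] at h1
    rw [tailPart_append _ _ _ (hB.lt w hw), tailPart_append _ _ _ hw'] at h2
    exact ⟨ht.2 t' ht' h1, h2⟩
  have head_le : ∀ s t w : List (Ordinal.{u} × D), (∀ x ∈ w, x.1 < a) → shiftD a s <+: shiftD a t ++ w → s <+: t := by
    intro s t w hw hp
    have h1 := headPart_prefix a hp
    rwa [headPart_shiftD, headPart_append _ _ _ hw] at h1
  refine ⟨⟨θ, e, ?_, ?_, ?_, ?_, ?_⟩, ?_⟩
  · rintro _ (⟨s, hs, rfl⟩ | ⟨t, ht, w, hw, rfl⟩)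
    · rw [θ_head]
      exact Or.inl ⟨_, P.map_mem s hs, rfl⟩
    · rw [θ_tail t w hw]
      exact Or.inr ⟨_, P.map_max t ht, _, (R t).map_mem w hw, rfl⟩
  · intro τ hτ
    obtain ⟨t, ht, w, hw, rfl⟩ := exists_of_mem_maxElts_concatTree hB hne hτ
    rw [e_tail t w hw.1]
    exact mem_maxElts_concatTree hB' (P.map_max t ht) ((R t).map_max w hw)
  · rintro _ (⟨s, hs, rfl⟩ | ⟨t, ht, w, hw, rfl⟩) _ (⟨s', hs', rfl⟩ | ⟨t', ht', w', hw', rfl⟩) hp hne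
    · rw [θ_head, θ_head]
      have := P.mono s hs s' hs' ((shiftD_prefix_iff a).1 hp) (fun h => hne (by rw [h]))
      exact ⟨(shiftD_prefix_iff a').2 this.1, fun h => this.2 (shiftD_injective a' h)⟩
    · rw [θ_head, θ_tail t' w' hw']
      have hp' := (shiftD_prefix_iff a').2
        (P.prefix_max hs ht' (head_le s t' w' (hB.lt w' hw') hp))
      refine ⟨hp'.trans (List.prefix_append _ _), fun h => ?_⟩
      rw [h] at hp'
      have h2 := hp'.length_le
      have h3 := List.length_pos_of_ne_nil (hB'.ne_nil _ ((R t').map_mem w' hw'))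
      rw [List.length_append] at h2
      omega
    · exfalso
      have := (cmp t ht w hw s' hs' [] (by simp) (by simpa using hp)).2
      exact hB.ne_nil w hw (List.prefix_nil.1 this)
    · obtain ⟨rfl, hw2⟩ := cmp t ht w hw t' ht'.1 w' (hB.lt w' hw') hp
      rw [θ_tail _ w hw, θ_tail _ w' hw']
      have := (R t').mono w hw w' hw' hw2 (fun h => hne (by rw [h]))
      exact ⟨(List.prefix_append_right_inj _).2 this.1, fun h => this.2 (List.append_cancel_left h)⟩
  · rintro _ (⟨s, hs, rfl⟩ | ⟨t, ht, w, hw, rfl⟩) x hx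
    · rw [θ_head]
      obtain ⟨y, hy, rfl⟩ := mem_getLast?_shiftD.1 hx
      obtain ⟨z, hz, hyz⟩ := P.le_last s hs y hy
      exact ⟨_, mem_getLast?_shiftD.2 ⟨z, hz, rfl⟩, hyz⟩
    · rw [θ_tail t w hw]
      rw [List.getLast?_append_of_ne_nil _ (hB.ne_nil w hw)] at hx
      rw [List.getLast?_append_of_ne_nil _ (hB'.ne_nil _ ((R t).map_mem w hw))]
      exact (R t).le_last w hw x hx
  · intro τ hτ
    obtain ⟨t, ht, w, hw, rfl⟩ := exists_of_mem_maxElts_concatTree hB hne hτ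
    rw [e_tail t w hw.1, θ_tail t w hw.1]
    exact (List.prefix_append_right_inj _).2 ((R t).prefix_e w hw)
  · intro τ hτ
    obtain ⟨t, ht, w, hw, rfl⟩ := exists_of_mem_maxElts_concatTree hB hne hτ
    change Ψ (e _) _
    rw [e_tail t w hw.1]
    refine hΨ _ _ _ ?_ (hR t ht w hw)
    rintro _ ⟨_, ⟨s, hs, rfl⟩ | ⟨t', ht', w', hw', rfl⟩, hp, rfl⟩
    · refine Or.inl ⟨P.θ s, ⟨s, hs, head_le s t w (hB.lt w hw.1) hp, rfl⟩, (θ_head s).symm⟩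
    · obtain ⟨rfl, hw2⟩ := cmp t' ht' w' hw' t ht.1 w (hB.lt w hw.1) hp
      exact Or.inr ⟨(R t).θ w', ⟨w', hw', hw2, rfl⟩, (θ_tail t w' hw').symm⟩

/-- A fixed branch `b` is inserted in front of everything, so the first stage of the target is
passed over and carries no marks. -/
theorem Prunes.concat_skip {S : Set (List (Ordinal.{u} × D))} (hB' : IsBelow a' B')
    {b : List (Ordinal.{u} × D)} (hb : b ∈ maxElts A')
    (h : Prunes S B' (fun w N => Ψ (shiftD a' b ++ w) ((shiftD a' b ++ ·) '' N))) :
    Prunes S (concatTree a' A' B') Ψ := by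
  refine Prunes.postcomp ⟨(shiftD a' b ++ ·), (shiftD a' b ++ ·), ?_, ?_, ?_, ?_, ?_⟩ h
  · intro w hw
    exact Or.inr ⟨b, hb, w, hw, rfl⟩
  · intro w hw
    exact mem_maxElts_concatTree hB' hb hw
  · intro w _ w' _ hp hne
    exact ⟨(List.prefix_append_right_inj _).2 hp, fun h => hne (List.append_cancel_left h)⟩
  · intro w hw x hx
    refine ⟨x, ?_, le_rfl⟩
    rwa [List.getLast?_append_of_ne_nil _ (hB'.ne_nil w hw)]
  · intro w _
    exact List.prefix_rfl

/-- All marks stay in the first stage of the target; only `e` is continued by `r` to a maximal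
branch. This uses the freedom that `e(τ)` may properly extend `θ(τ)`. -/
theorem Prunes.concat_last {S T : Set (List (Ordinal.{u} × D))} (hT : shiftD a' '' A' ⊆ T)
    (h : Prunes S A' (fun b M => ∃ r, shiftD a' b ++ r ∈ maxElts T ∧
      Ψ (shiftD a' b ++ r) (shiftD a' '' M))) :
    Prunes S T Ψ := by
  classical
  obtain ⟨P, hP⟩ := h
  choose! r hr hΨ using hP
  refine ⟨⟨fun τ => shiftD a' (P.θ τ), fun τ => shiftD a' (P.e τ) ++ r τ, ?_, ?_, ?_, ?_, ?_⟩, ?_⟩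
  · exact fun τ hτ => hT ⟨_, P.map_mem τ hτ, rfl⟩
  · exact hr
  · intro s hs s' hs' hp hne
    have := P.mono s hs s' hs' hp hne
    exact ⟨(shiftD_prefix_iff a').2 this.1, fun h => this.2 (shiftD_injective a' h)⟩
  · intro s hs x hx
    obtain ⟨z, hz, hxz⟩ := P.le_last s hs x hx
    exact ⟨_, mem_getLast?_shiftD.2 ⟨z, hz, rfl⟩, hxz⟩
  · intro τ hτ
    exact ((shiftD_prefix_iff a').2 (P.prefix_e τ hτ)).trans (List.prefix_append _ _)
  · intro τ hτ
    convert hΨ τ hτ using 1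
    ext x
    constructor
    · rintro ⟨s, hs, hp, rfl⟩
      exact ⟨_, ⟨s, hs, hp, rfl⟩, rfl⟩
    · rintro ⟨_, ⟨s, hs, hp, rfl⟩, rfl⟩
      exact ⟨s, hs, hp, rfl⟩

end Concat

/-! ### The trees `Ω_{ξ,n}` and the components of `Ω_ξ`. -/

section Levels

open Ordinal

variable {D : Type v}

theorem map_fst_mem_maxElts {Λ : Type*} {T : Set (List Λ)} {τ : List (Λ × D)} (hT : [] ∉ T)
    (h : τ ∈ maxElts (treeProd T D)) : τ.map Prod.fst ∈ maxElts T := by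
  refine ⟨h.1, ?_⟩
  rintro _ hs ⟨r, rfl⟩
  obtain ⟨x, τ', hτ⟩ := List.exists_cons_of_ne_nil
    (show τ ≠ [] by rintro rfl; exact hT h.1)
  have := h.2 (τ ++ r.map (fun y => (y, x.2)))
    (by simpa [treeProd, Function.comp_def] using hs) (List.prefix_append _ _)
  have hr : r = [] := by simpa using this
  rw [hr, List.append_nil]

theorem mem_maxElts_treeProd {Λ : Type*} {T : Set (List Λ)} {τ : List (Λ × D)}
    (h : τ.map Prod.fst ∈ maxElts T) : τ ∈ maxElts (treeProd T D) := by
  refine ⟨h.1, ?_⟩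
  rintro _ hs ⟨r, rfl⟩
  have := h.2 _ hs (by simp)
  have hr : r = [] := by simpa using this
  rw [hr, List.append_nil]

theorem exists_map_fst_eq [Nonempty D] {Λ : Type*} (t : List Λ) :
    ∃ τ : List (Λ × D), τ.map Prod.fst = t := by
  obtain ⟨d⟩ := ‹Nonempty D›
  exact ⟨t.map (fun x => (x, d)), by simp [Function.comp_def]⟩

theorem maxElts_Omg_nonempty [Nonempty D] (ξ : Ordinal.{u}) : (maxElts (Omg ξ D)).Nonempty := by
  obtain ⟨⟨s, hs⟩, h⟩ := exists_weight ξ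
  obtain ⟨t, ht, -⟩ := h s hs
  obtain ⟨τ, rfl⟩ := exists_map_fst_eq (D := D) t
  exact ⟨τ, mem_maxElts_treeProd ht⟩

/-- `Ω_{ξ,n}`, the `n`-fold concatenation of `Ω_ξ`. -/
def levelOmg (ξ : Ordinal.{u}) (D : Type v) (n : ℕ) : Set (List (Ordinal.{u} × D)) :=
  treeProd (gammaLevel ξ (Gam ξ) n) D

theorem levelOmg_zero (ξ : Ordinal.{u}) : levelOmg ξ D 0 = ∅ := by
  simp [levelOmg, gammaLevel, treeProd]

theorem levelOmg_one (ξ : Ordinal.{u}) : levelOmg ξ D 1 = Omg ξ D := by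
  rw [levelOmg, gammaLevel_one, Omg]

theorem exists_shiftD_of_map_fst {a : Ordinal.{u}} {τ : List (Ordinal.{u} × D)}
    {s : List Ordinal.{u}} (h : τ.map Prod.fst = shift a s) :
    ∃ σ : List (Ordinal.{u} × D), σ.map Prod.fst = s ∧ τ = shiftD a σ := by
  induction s generalizing τ with
  | nil =>
    simp only [shift, List.map_nil, List.map_eq_nil_iff] at h
    exact ⟨[], rfl, h⟩
  | cons x s ih =>
    obtain ⟨y, τ', rfl, h1, h2⟩ := List.map_eq_cons_iff.1 h
    obtain ⟨σ, rfl, rfl⟩ := ih h2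
    refine ⟨(x, y.2) :: σ, rfl, ?_⟩
    simp [shiftD, Prod.map, ← h1]

theorem levelOmg_succ (ξ : Ordinal.{u}) (n : ℕ) :
    levelOmg ξ D (n + 1) = concatTree (omega0 ^ ξ * n) (Omg ξ D) (levelOmg ξ D n) := by
  ext τ
  constructor
  · rintro (⟨s, hs, h⟩ | ⟨t, ht, w, hw, h⟩)
    · obtain ⟨σ, rfl, rfl⟩ := exists_shiftD_of_map_fst h
      exact Or.inl ⟨σ, hs, rfl⟩
    · obtain ⟨τ₁, τ₂, rfl, h1, rfl⟩ := List.map_eq_append_iff.1 h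
      obtain ⟨σ, rfl, rfl⟩ := exists_shiftD_of_map_fst h1
      exact Or.inr ⟨σ, mem_maxElts_treeProd ht, τ₂, hw, rfl⟩
  · rintro (⟨s, hs, rfl⟩ | ⟨t, ht, w, hw, rfl⟩)
    · exact Or.inl ⟨_, hs, shiftD_map_fst _ _⟩
    · refine Or.inr ⟨_, map_fst_mem_maxElts (isBTree_Gam ξ).1 ht, _, hw, ?_⟩
      rw [List.map_append, shiftD_map_fst]

theorem isBelow_levelOmg (ξ : Ordinal.{u}) (n : ℕ) :
    IsBelow (omega0 ^ ξ * n) (levelOmg ξ D n) where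
  lt w hw x hx := gammaLevel_lt (Gam_lt ξ) n _ hw _ (List.mem_map_of_mem hx)
  ne_nil := by
    rintro w hw rfl
    exact (isBTree_gammaLevel (isBTree_Gam ξ) n).1 hw

theorem levelOmg_nonempty [Nonempty D] (ξ : Ordinal.{u}) (n : ℕ) :
    (levelOmg ξ D (n + 1)).Nonempty := by
  obtain ⟨τ, hτ⟩ := maxElts_Omg_nonempty (D := D) ξ
  rw [levelOmg_succ]
  exact ⟨_, Or.inl ⟨τ, hτ.1, rfl⟩⟩

/-- `[b_1, …, b_n] ↦ (ω^ξ(n-1) + b_1) ⌢ … ⌢ (ω^ξ 0 + b_n)`. -/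
noncomputable def stageConcat (ξ : Ordinal.{u}) :
    List (List (Ordinal.{u} × D)) → List (Ordinal.{u} × D)
  | [] => []
  | b :: bs => shiftD (omega0 ^ ξ * bs.length) b ++ stageConcat ξ bs

theorem shiftD_zero (τ : List (Ordinal.{u} × D)) : shiftD 0 τ = τ := by
  conv_rhs => rw [← List.map_id τ]
  rw [shiftD]
  congr 1
  funext x
  simp [Prod.map]

theorem stageConcat_mem_maxElts {ξ : Ordinal.{u}} (b : List (Ordinal.{u} × D))
    (bs : List (List (Ordinal.{u} × D))) (hb : b ∈ maxElts (Omg ξ D))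
    (h : ∀ x ∈ bs, x ∈ maxElts (Omg ξ D)) :
    stageConcat ξ (b :: bs) ∈ maxElts (levelOmg ξ D (bs.length + 1)) := by
  induction bs generalizing b with
  | nil => simpa [stageConcat, levelOmg_one, shiftD_zero] using hb
  | cons c bs ih =>
    rw [levelOmg_succ, stageConcat]
    exact mem_maxElts_concatTree (isBelow_levelOmg ξ _) hb
      (ih c (h c (by simp)) fun x hx => h x (by simp [hx]))

theorem gammaLevel_head {ξ : Ordinal.{u}} (n : ℕ) :
    ∀ τ ∈ gammaLevel ξ (Gam ξ) n, ∃ x l, τ = x :: l ∧ x / omega0 ^ ξ + 1 = n := by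
  have hp := (opow_pos ξ omega0_pos).ne'
  rcases n with _ | n
  · simp [gammaLevel]
  · have key : ∀ s ∈ Gam ξ, ∀ r, ∃ x l, shift (omega0 ^ ξ * n) s ++ r = x :: l ∧
        x / omega0 ^ ξ + 1 = (n + 1 : ℕ) := by
      intro s hs r
      obtain ⟨x, l, rfl⟩ := List.exists_cons_of_ne_nil
        (show s ≠ [] by rintro rfl; exact (isBTree_Gam ξ).1 hs)
      refine ⟨_, _, rfl, ?_⟩
      rw [mul_add_div _ hp, div_eq_zero_of_lt (Gam_lt ξ _ hs x (by simp))]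
      simp
    rintro _ (⟨s, hs, rfl⟩ | ⟨t, ht, w, hw, rfl⟩)
    · simpa using key s hs []
    · exact key t ht.1 w

/-- Comparable nonempty sequences have the same first ordinal, so it is enough that this ordinal
determines the component. At a successor it does so through its quotient by `ω^ξ`, at a limit
through its logarithm to base `ω`. -/
theorem isComponents_of_map_fst {ι : Type*} {T : Set (List Ordinal.{u})}
    {A : ι → Set (List Ordinal.{u})} (hT : ∀ t, t ∈ T ↔ ∃ i, t ∈ A i)
    (f : Ordinal.{u} → ι) (hf : ∀ i, ∀ t ∈ A i, ∃ x l, t = x :: l ∧ f x = i) :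
    IsComponents (fun i => treeProd (A i) D) (treeProd T D) where
  subset i τ h := (hT _).2 ⟨i, h⟩
  cover τ h := (hT _).1 h
  sep i j τ hτ τ' hτ' hp := by
    obtain ⟨x, l, h1, rfl⟩ := hf i _ hτ
    obtain ⟨y, l', h2, rfl⟩ := hf j _ hτ'
    have := hp.map Prod.fst
    rw [h1, h2, List.cons_prefix_cons] at this
    rw [this.1]

theorem isComponents_add_one (ξ : Ordinal.{u}) :
    IsComponents (levelOmg ξ D) (Omg (ξ + 1) D) := by
  classical
  have inj : ∀ n m : ℕ, (n : Ordinal.{u}) = m → n = m := fun n m h => by exact_mod_cast h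
  refine isComponents_of_map_fst (by simp [Gam_add_one])
    (fun x => if h : ∃ n : ℕ, x / omega0 ^ ξ + 1 = n then h.choose else 0) ?_
  intro n t ht
  obtain ⟨x, l, rfl, hx⟩ := gammaLevel_head n t ht
  refine ⟨x, l, rfl, ?_⟩
  have hex : ∃ n : ℕ, x / omega0 ^ ξ + 1 = n := ⟨n, hx⟩
  exact (dif_pos hex).trans (inj _ _ (hex.choose_spec.symm.trans hx))

theorem treeProd_image_shift (a : Ordinal.{u}) (T : Set (List Ordinal.{u})) :
    treeProd (shift a '' T) D = shiftD a '' treeProd T D := by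
  ext τ
  constructor
  · rintro ⟨s, hs, h⟩
    obtain ⟨σ, rfl, rfl⟩ := exists_shiftD_of_map_fst h.symm
    exact ⟨σ, hs, rfl⟩
  · rintro ⟨σ, hσ, rfl⟩
    exact ⟨_, hσ, (shiftD_map_fst a σ).symm⟩

theorem isComponents_limit {ξ : Ordinal.{u}} (hξ : Order.IsSuccLimit ξ) :
    IsComponents (fun ζ : Set.Iio ξ => shiftD (omega0 ^ ζ.1) '' Omg (ζ.1 + 1) D) (Omg ξ D) := by
  classical
  simp only [Omg, ← treeProd_image_shift]
  refine isComponents_of_map_fst (A := fun ζ : Set.Iio ξ => shift (omega0 ^ ζ.1) '' Gam (ζ.1 + 1))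
    (by simp [Gam_limit hξ])
    (fun x => if h : Ordinal.log omega0 x ∈ Set.Iio ξ then ⟨_, h⟩ else ⟨0, hξ.bot_lt⟩) ?_
  rintro ⟨ζ, hζ⟩ _ ⟨t, ht, rfl⟩
  obtain ⟨x, l, rfl⟩ := List.exists_cons_of_ne_nil
    (show t ≠ [] by rintro rfl; exact (isBTree_Gam _).1 ht)
  refine ⟨_, _, rfl, ?_⟩
  have e := log_opow_add ζ x (Gam_lt _ _ ht x (by simp))
  exact (dif_pos (show Ordinal.log omega0 (omega0 ^ ζ + x) ∈ Set.Iio ξ by rw [e]; exact hζ)).trans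
    (Subtype.ext e)

/-- `Ω_ξ` is the component `Ω_{ξ,1}` of `Ω_{ξ+1}`, and a shift of `Ω_{ζ+1}` is a component of `Ω_ξ`
for limit `ξ > ζ`. -/
theorem nonempty_pruneMap_Omg [Preorder D] {ζ ξ : Ordinal.{u}} (h : ζ ≤ ξ) :
    Nonempty (PruneMap (Omg ζ D) (Omg ξ D)) := by
  have succ : ∀ ξ : Ordinal.{u}, Nonempty (PruneMap (Omg ξ D) (Omg (ξ + 1) D)) := fun ξ => by
    rw [← levelOmg_one ξ]
    exact ⟨(isComponents_add_one ξ).incl 1⟩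
  induction ξ using Ordinal.limitRecOn with
  | zero =>
    obtain rfl : ζ = 0 := le_antisymm h zero_le
    exact ⟨PruneMap.refl _⟩
  | add_one ξ ih =>
    rcases h.eq_or_lt with rfl | h
    · exact ⟨PruneMap.refl _⟩
    · obtain ⟨P⟩ := ih (Order.lt_add_one_iff.1 h)
      obtain ⟨Q⟩ := succ ξ
      exact ⟨Q.comp P⟩
  | limit ξ hξ ih =>
    rcases h.eq_or_lt with rfl | h
    · exact ⟨PruneMap.refl _⟩
    · obtain ⟨P⟩ := succ ζ
      exact ⟨((isComponents_limit hξ).incl ⟨ζ, h⟩).comp ((shiftMap _ _).comp P)⟩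

end Levels

/-! ### Weighted averages along branches. -/

section Weights

open Ordinal

variable {D : Type v}

theorem HasWeight.nonneg {ξ : Ordinal.{u}} {s t : List Ordinal.{u}} {w : ℝ}
    (h : HasWeight ξ s t w) : 0 ≤ w := by
  induction h with
  | zero => exact zero_le_one
  | add_one ξ l t' r n s' w hn hmax hw ih => positivity
  | limit ξ ζ s' t' w hξ hζ hw ih => exact ih

theorem prob_nonneg (ξ : Ordinal.{u}) (s : List Ordinal.{u}) : 0 ≤ prob ξ s := by
  rw [prob]
  split_ifs with h
  · obtain ⟨t, ht⟩ := h.choose_spec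
    exact ht.nonneg
  · exact le_rfl

theorem prob_zero : prob.{u} 0 [0] = 1 := HasWeight.zero.prob_eq

theorem prob_limit {ξ ζ : Ordinal.{u}} (hξ : Order.IsSuccLimit ξ) (hζ : ζ < ξ)
    {s : List Ordinal.{u}} (hs : s ∈ Gam (ζ + 1)) :
    prob ξ (shift (omega0 ^ ζ) s) = prob (ζ + 1) s := by
  obtain ⟨t, -, w, hw⟩ := (exists_weight (ζ + 1)).2 s hs
  rw [hw.prob_eq, (HasWeight.limit ξ ζ s t w hξ hζ hw).prob_eq]

theorem prob_levelConcat {ξ : Ordinal.{u}} {l : List (List Ordinal.{u})} {n : ℕ}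
    {s : List Ordinal.{u}} (hl : ∀ x ∈ l, x ∈ maxElts (Gam ξ)) (hn : l.length < n)
    (hs : s ∈ Gam ξ) : prob (ξ + 1) (levelConcat ξ n (l ++ [s])) = prob ξ s / n := by
  obtain ⟨t, ht, w, hw⟩ := (exists_weight ξ).2 s hs
  have h := HasWeight.add_one ξ l t (List.replicate (n - l.length - 1) t) n s w
    (by simp; omega) (by
      intro x hx
      simp only [List.mem_append, List.mem_cons, List.mem_replicate] at hx
      rcases hx with hx | rfl | ⟨-, rfl⟩
      · exact hl x hx
      · exact ht
      · exact ht) hw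
  rw [h.prob_eq, hw.prob_eq]

theorem exists_levelConcat {ξ : Ordinal.{u}} (n : ℕ) :
    ∀ s ∈ gammaLevel ξ (Gam ξ) n, ∃ l s', (∀ x ∈ l, x ∈ maxElts (Gam ξ)) ∧
      s' ∈ Gam ξ ∧ l.length < n ∧ s = levelConcat ξ n (l ++ [s']) := by
  induction n with
  | zero => simp [gammaLevel]
  | succ n ih =>
    rintro s (⟨t, ht, rfl⟩ | ⟨t, ht, v, hv, rfl⟩)
    · exact ⟨[], t, by simp, ht, by simp, by simp [levelConcat]⟩
    · obtain ⟨l, s', h1, h2, h3, rfl⟩ := ih v hv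
      exact ⟨t :: l, s', by simpa using ⟨ht, h1⟩, h2, by simpa using h3, rfl⟩

theorem prob_shift {ξ : Ordinal.{u}} {s : List Ordinal.{u}} (hs : s ∈ Gam ξ) (n : ℕ) :
    ((n + 1 : ℕ) : ℝ) * prob (ξ + 1) (shift (omega0 ^ ξ * n) s) = prob ξ s := by
  have := prob_levelConcat (l := []) (n := n + 1) (by simp) (by simp) hs
  simp only [List.nil_append, levelConcat, List.append_nil] at this
  rw [this]
  field_simp

theorem prob_shift_append {ξ : Ordinal.{u}} {t s : List Ordinal.{u}} {n : ℕ}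
    (ht : t ∈ maxElts (Gam ξ)) (hs : s ∈ gammaLevel ξ (Gam ξ) n) :
    ((n + 1 : ℕ) : ℝ) * prob (ξ + 1) (shift (omega0 ^ ξ * n) t ++ s) = n * prob (ξ + 1) s := by
  obtain ⟨l, s', h1, h2, h3, rfl⟩ := exists_levelConcat n s hs
  have := prob_levelConcat (l := t :: l) (n := n + 1) (by simpa using ⟨ht, h1⟩)
    (by simpa using h3) h2
  rw [List.cons_append, levelConcat] at this
  rw [this, prob_levelConcat h1 h3 h2]
  have : (n : ℝ) ≠ 0 := by
    have : n ≠ 0 := by omega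
    exact_mod_cast this
  field_simp

/-- The average of `f` over the nonempty initial segments of `b` with weights `ℙ_ξ`. -/
noncomputable def wavg (ξ : Ordinal.{u}) (b : List (Ordinal.{u} × D))
    (f : List (Ordinal.{u} × D) → ℝ) : ℝ :=
  ∑ i ∈ Finset.range b.length, prob ξ ((b.take (i + 1)).map Prod.fst) * f (b.take (i + 1))

theorem take_succ_ne_nil {α : Type*} {b : List α} {i : ℕ} (hi : i < b.length) :
    b.take (i + 1) ≠ [] := by
  intro h
  rcases List.take_eq_nil_iff.1 h with h | h
  · simp at h
  · simp [h] at hi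

/-- Passing from `n` to `n + 1` stages replaces the factor `1/n` in the weights by `1/(n+1)`;
multiplying by the number of stages avoids division and includes the case of empty `bs`. -/
theorem wavg_stageConcat {ξ : Ordinal.{u}} {b : List (Ordinal.{u} × D)}
    {bs : List (List (Ordinal.{u} × D))} (hb : b ∈ maxElts (Omg ξ D))
    (h : ∀ x ∈ bs, x ∈ maxElts (Omg ξ D)) (f : List (Ordinal.{u} × D) → ℝ) :
    ((bs.length + 1 : ℕ) : ℝ) * wavg (ξ + 1) (stageConcat ξ (b :: bs)) f =
      wavg ξ b (fun s => f (shiftD (omega0 ^ ξ * bs.length) s)) +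
      bs.length * wavg (ξ + 1) (stageConcat ξ bs)
        (fun s => f (shiftD (omega0 ^ ξ * bs.length) b ++ s)) := by
  have hlen : (shiftD (omega0 ^ ξ * bs.length) b).length = b.length := by simp [shiftD]
  simp only [wavg, stageConcat, List.length_append, hlen, Finset.sum_range_add, mul_add,
    Finset.mul_sum]
  congr 1
  · refine Finset.sum_congr rfl fun i hi => ?_
    have hi := Finset.mem_range.1 hi
    have htake : (shiftD (omega0 ^ ξ * bs.length) b ++ stageConcat ξ bs).take (i + 1) =
        shiftD (omega0 ^ ξ * bs.length) (b.take (i + 1)) := by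
      rw [List.take_append_of_le_length (by rw [hlen]; exact hi), shiftD, shiftD, List.map_take]
    have hmem : b.take (i + 1) ∈ Omg ξ D :=
      (isBTree_Omg ξ D).2 b hb.1 _ (take_succ_ne_nil hi) (List.take_prefix _ _)
    rw [htake, shiftD_map_fst, ← mul_assoc, prob_shift hmem]
  · refine Finset.sum_congr rfl fun i hi => ?_
    have hi := Finset.mem_range.1 hi
    have htake : (shiftD (omega0 ^ ξ * bs.length) b ++ stageConcat ξ bs).take (b.length + i + 1) =
        shiftD (omega0 ^ ξ * bs.length) b ++ (stageConcat ξ bs).take (i + 1) := by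
      rw [List.take_append, List.take_of_length_le (by rw [hlen]; omega), hlen]
      congr 2
      omega
    rcases bs with _ | ⟨c, bs⟩
    · simp [stageConcat] at hi
    · have hm := stageConcat_mem_maxElts c bs (h c (by simp)) fun x hx => h x (by simp [hx])
      have hmem : ((stageConcat ξ (c :: bs)).take (i + 1)).map Prod.fst ∈
          gammaLevel ξ (Gam ξ) (c :: bs).length :=
        (isBTree_gammaLevel (isBTree_Gam ξ) _).2 _ hm.1 _
          (by simpa using take_succ_ne_nil hi) ((List.take_prefix _ _).map _)
      rw [htake, List.map_append, shiftD_map_fst, ← mul_assoc, ← mul_assoc,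
        prob_shift_append (map_fst_mem_maxElts (isBTree_Gam ξ).1 hb) hmem]

theorem wavg_limit {ξ ζ : Ordinal.{u}} (hξ : Order.IsSuccLimit ξ) (hζ : ζ < ξ)
    {b : List (Ordinal.{u} × D)} (hb : b ∈ Omg (ζ + 1) D) (f : List (Ordinal.{u} × D) → ℝ) :
    wavg ξ (shiftD (omega0 ^ ζ) b) f = wavg (ζ + 1) b (fun s => f (shiftD (omega0 ^ ζ) s)) := by
  have hlen : (shiftD (omega0 ^ ζ) b).length = b.length := by simp [shiftD]
  rw [wavg, wavg, hlen]
  refine Finset.sum_congr rfl fun i hi => ?_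
  have hi := Finset.mem_range.1 hi
  have htake : (shiftD (omega0 ^ ζ) b).take (i + 1) = shiftD (omega0 ^ ζ) (b.take (i + 1)) := by
    rw [shiftD, shiftD, List.map_take]
  have hmem : b.take (i + 1) ∈ Omg (ζ + 1) D :=
    (isBTree_Omg _ D).2 b hb _ (take_succ_ne_nil hi) (List.take_prefix _ _)
  rw [htake, shiftD_map_fst, prob_limit hξ hζ hmem]

theorem exists_stageConcat [Nonempty D] {ξ : Ordinal.{u}} (n : ℕ) :
    ∀ τ ∈ maxElts (levelOmg ξ D (n + 1)), ∃ b bs, bs.length = n ∧ b ∈ maxElts (Omg ξ D) ∧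
      (∀ x ∈ bs, x ∈ maxElts (Omg ξ D)) ∧ τ = stageConcat ξ (b :: bs) := by
  induction n with
  | zero =>
    intro τ hτ
    rw [levelOmg_one] at hτ
    exact ⟨τ, [], rfl, hτ, by simp, by simp [stageConcat, shiftD_zero]⟩
  | succ n ih =>
    intro τ hτ
    rw [levelOmg_succ] at hτ
    obtain ⟨b, hb, w, hw, rfl⟩ := exists_of_mem_maxElts_concatTree (isBelow_levelOmg ξ _)
      (levelOmg_nonempty ξ n) hτ
    obtain ⟨c, bs, rfl, hc, hbs, rfl⟩ := ih w hw
    exact ⟨b, c :: bs, rfl, hb, by simpa using ⟨hc, hbs⟩, rfl⟩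

/-- The weights `ℙ_ξ` sum to `1` along every maximal branch. -/
theorem wavg_const [Nonempty D] {ξ : Ordinal.{u}} {b : List (Ordinal.{u} × D)}
    (hb : b ∈ maxElts (Omg ξ D)) (c : ℝ) : wavg ξ b (fun _ => c) = c := by
  induction ξ using Ordinal.limitRecOn generalizing b with
  | zero =>
    have h : b.map Prod.fst = [0] := by
      have := hb.1
      rwa [Omg, Gam_zero] at this
    obtain ⟨x, l, rfl, hx, hl⟩ := List.map_eq_cons_iff.1 h
    obtain rfl : l = [] := by simpa using hl
    simp [wavg, hx, prob_zero]
  | add_one ξ ih =>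
    obtain ⟨n, hn⟩ := (isComponents_add_one ξ).cover b hb.1
    rcases n with _ | n
    · simp [levelOmg_zero] at hn
    · have hb' : b ∈ maxElts (levelOmg ξ D (n + 1)) :=
        ⟨hn, fun s hs hp => hb.2 s ((isComponents_add_one ξ).subset _ hs) hp⟩
      obtain ⟨b, bs, -, hb1, hbs, rfl⟩ := exists_stageConcat n b hb'
      have key : ∀ bs : List (List (Ordinal.{u} × D)), (∀ x ∈ bs, x ∈ maxElts (Omg ξ D)) →
          (bs.length : ℝ) * wavg (ξ + 1) (stageConcat ξ bs) (fun _ => c) = bs.length * c := by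
        intro bs hbs
        induction bs with
        | nil => simp
        | cons b bs ihb =>
          rw [List.length_cons, wavg_stageConcat (hbs b (by simp)) fun x hx => hbs x (by simp [hx]),
            ihb fun x hx => hbs x (by simp [hx]), ih (hbs b (by simp))]
          push_cast
          ring
      have := key (b :: bs) (by simpa using ⟨hb1, hbs⟩)
      exact mul_left_cancel₀ (by simp; positivity) this
  | limit ξ hξ ih =>
    obtain ⟨⟨ζ, hζ⟩, τ, hτ, rfl⟩ := (isComponents_limit hξ).cover b hb.1
    rw [wavg_limit hξ hζ hτ]
    refine ih _ (hξ.add_one_lt hζ) ⟨hτ, fun s hs hp => ?_⟩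
    exact shiftD_injective _ (hb.2 _ ((isComponents_limit hξ).subset ⟨ζ, hζ⟩ ⟨s, hs, rfl⟩)
      ((shiftD_prefix_iff _).2 hp))

theorem wavg_le {ξ : Ordinal.{u}} {b : List (Ordinal.{u} × D)} (hb : b ∈ Omg ξ D)
    {f f' : List (Ordinal.{u} × D) → ℝ} (h : ∀ s ∈ Omg ξ D, s <+: b → f s ≤ f' s) :
    wavg ξ b f ≤ wavg ξ b f' := by
  refine Finset.sum_le_sum fun i hi => ?_
  refine mul_le_mul_of_nonneg_left (h _ ?_ (List.take_prefix _ _)) (prob_nonneg _ _)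
  exact (isBTree_Omg ξ D).2 b hb _ (take_succ_ne_nil (Finset.mem_range.1 hi)) (List.take_prefix _ _)

theorem wavg_add (ξ : Ordinal.{u}) (b : List (Ordinal.{u} × D))
    (f f' : List (Ordinal.{u} × D) → ℝ) :
    wavg ξ b (fun s => f s + f' s) = wavg ξ b f + wavg ξ b f' := by
  simp only [wavg, mul_add, Finset.sum_add_distrib]

end Weights

/-! ### Successive prunings and the Ramsey property. -/

section Strategies

variable {Λ : Type*} {D : Type v} {S : Set (List (Λ × D))}

/-- An outcome of a pruning: a maximal branch `e(τ)` with the set of marks `θ(s)`, `s ⪯ τ`. -/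
abbrev Outcome (Λ : Type*) (D : Type*) := List (Λ × D) × Set (List (Λ × D))

/-- The outcomes whose branch lies in `MAX(S)`, with marks that are initial segments in `S`. -/
def IsOutcome (S : Set (List (Λ × D))) (x : Outcome Λ D) : Prop :=
  x.1 ∈ maxElts S ∧ ∀ s ∈ x.2, s ∈ S ∧ s <+: x.1

/-- `Φ` is inherited by smaller sets of marks. -/
def OutcomeAntitone (Φ : List (Outcome Λ D) → Prop) : Prop :=
  ∀ l l', List.Forall₂ (fun x y : Outcome Λ D => x.1 = y.1 ∧ x.2 ⊆ y.2) l l' → Φ l' → Φ l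

theorem forall₂_outcome_refl (l : List (Outcome Λ D)) :
    List.Forall₂ (fun x y : Outcome Λ D => x.1 = y.1 ∧ x.2 ⊆ y.2) l l := by
  induction l with
  | nil => exact .nil
  | cons x l ih => exact .cons ⟨rfl, subset_rfl⟩ ih

variable [Preorder D]

/-- `n` successive prunings of `S`, each depending on the previous branches, can be chosen so that
the list of outcomes always satisfies `Φ`. -/
def Strat (S : Set (List (Λ × D))) : ℕ → (List (Outcome Λ D) → Prop) → Prop
  | 0, Φ => Φ []
  | n + 1, Φ => Prunes S S (fun b M => Strat S n (fun l => Φ ((b, M) :: l)))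

theorem Strat.mono {n : ℕ} {Φ Φ' : List (Outcome Λ D) → Prop} (h : Strat S n Φ)
    (hΦ : ∀ l, l.length = n → (∀ x ∈ l, IsOutcome S x) → Φ l → Φ' l) : Strat S n Φ' := by
  induction n generalizing Φ Φ' with
  | zero => exact hΦ [] rfl (by simp) h
  | succ n ih =>
    refine Prunes.mono h fun b hb M hM h' => ih h' fun l hl hlS => ?_
    refine hΦ _ (by simp [hl]) ?_
    intro x hx
    rcases List.mem_cons.1 hx with rfl | hx
    · exact ⟨hb, hM⟩
    · exact hlS x hx

theorem Strat.exists (hS : (maxElts S).Nonempty) {n : ℕ} {Φ : List (Outcome Λ D) → Prop}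
    (h : Strat S n Φ) : ∃ l, l.length = n ∧ (∀ x ∈ l, IsOutcome S x) ∧ Φ l := by
  induction n generalizing Φ with
  | zero => exact ⟨[], rfl, by simp, h⟩
  | succ n ih =>
    obtain ⟨P, hP⟩ := h
    obtain ⟨τ, hτ⟩ := hS
    obtain ⟨l, hl, hlS, hΦ⟩ := ih (hP τ hτ)
    refine ⟨_, by simp [hl], ?_, hΦ⟩
    intro x hx
    rcases List.mem_cons.1 hx with rfl | hx
    · exact ⟨P.map_max τ hτ, P.marks_spec hτ⟩
    · exact hlS x hx

theorem Strat.trivial (S : Set (List (Λ × D))) (n : ℕ) {Φ : List (Outcome Λ D) → Prop}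
    (h : ∀ l, Φ l) : Strat S n Φ := by
  induction n generalizing Φ with
  | zero => exact h _
  | succ n ih => exact ⟨PruneMap.refl S, fun τ _ => ih fun l => h _⟩

/-- Every finite colouring of `MAX(S)` is constant along some pruning. -/
def IsRamsey (S : Set (List (Λ × D))) : Prop :=
  ∀ (K : Type) [Finite K] (c : List (Λ × D) → K),
    ∃ k, ∃ Q : PruneMap S S, ∀ τ ∈ maxElts S, c (Q.e τ) = k

/-- The colours are tested one at a time: either a colour becomes constant along a pruning, or it is
avoided and the palette shrinks. The palette cannot become empty, since maximal elements exist. -/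
theorem isRamsey_of_split (hS : (maxElts S).Nonempty)
    (h : ∀ V : List (Λ × D) → Prop, ∃ Q : PruneMap S S,
      (∀ τ ∈ maxElts S, V (Q.e τ)) ∨ ∀ τ ∈ maxElts S, ¬ V (Q.e τ)) : IsRamsey S := by
  classical
  intro K _ c
  have := Fintype.ofFinite K
  have key : ∀ (K' : Finset K) (P : PruneMap S S), (∀ τ ∈ maxElts S, c (P.e τ) ∈ K') →
      ∃ k, ∃ Q : PruneMap S S, ∀ τ ∈ maxElts S, c (Q.e τ) = k := by
    intro K'
    induction K' using Finset.induction_on with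
    | empty =>
      intro P hP
      obtain ⟨τ, hτ⟩ := hS
      simpa using hP τ hτ
    | insert k K' _ ih =>
      intro P hP
      obtain ⟨Q, hQ | hQ⟩ := h (fun b => c (P.e b) = k)
      · exact ⟨k, P.comp Q, hQ⟩
      · exact ih (P.comp Q) fun τ hτ =>
          (Finset.mem_insert.1 (hP _ (Q.map_max τ hτ))).resolve_left (hQ τ hτ)
  exact key Finset.univ (PruneMap.refl S) (by simp)

/-- For each branch of the first stage the later stages are refined to a colour depending only on
that branch; this is a colouring of `MAX(S)`, made constant by one more pruning. -/
theorem Strat.color (hS : IsRamsey S) {K : Type} [Finite K] {n : ℕ}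
    {Φ : List (Outcome Λ D) → Prop} (hΦ : OutcomeAntitone Φ) (h : Strat S n Φ)
    (c : List (List (Λ × D)) → K) :
    ∃ k, Strat S n (fun l => Φ l ∧ c (l.map Prod.fst) = k) := by
  induction n generalizing Φ c with
  | zero => exact ⟨_, h, rfl⟩
  | succ n ih =>
    obtain ⟨P, hP⟩ := h
    have : Nonempty K := ⟨c []⟩
    have hk : ∀ τ ∈ maxElts S, ∃ k, Strat S n (fun l =>
        Φ ((P.e τ, P.marks τ) :: l) ∧ c (P.e τ :: l.map Prod.fst) = k) := fun τ hτ =>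
      ih (fun l l' hl => hΦ _ _ (.cons ⟨rfl, subset_rfl⟩ hl)) (hP τ hτ)
        fun bs => c (P.e τ :: bs)
    choose! col hcol using hk
    obtain ⟨k, Q, hQ⟩ := hS K col
    refine ⟨k, P.comp Q, fun τ hτ => ?_⟩
    refine (hcol _ (Q.map_max τ hτ)).mono fun l _ _ hl => ⟨?_, ?_⟩
    · exact hΦ _ ((P.e (Q.e τ), P.marks (Q.e τ)) :: l) (.cons ⟨rfl, P.marks_comp_subset Q hτ⟩ (forall₂_outcome_refl l)) hl.1
    · rw [← hQ τ hτ]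
      exact hl.2

end Strategies

/-! ### Large and small stages of a concatenation. -/

section Stages

open Ordinal

variable {D : Type v} {ξ : Ordinal.{u}}

/-- The condition on the outcomes of successive stages that `F` is at least `c - δ` on the marks
of the stages flagged `true`, and has `w`-average less than `c` on the other stages. -/
def StageCond (ξ : Ordinal.{u})
    (w : List (Ordinal.{u} × D) → (List (Ordinal.{u} × D) → ℝ) → ℝ) (c δ : ℝ) :
    List Bool → (List (Ordinal.{u} × D) → List (Ordinal.{u} × D) → ℝ) →
      List (Outcome Ordinal.{u} D) → Prop
  | [], _, _ => True
  | _ :: _, _, [] => False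
  | a :: A, F, x :: l =>
      (if a then ∀ s ∈ x.2, c - δ ≤ F (shiftD (omega0 ^ ξ * A.length) s)
          (shiftD (omega0 ^ ξ * A.length) x.1 ++ stageConcat ξ (l.map Prod.fst))
        else w x.1 (fun s => F (shiftD (omega0 ^ ξ * A.length) s)
          (shiftD (omega0 ^ ξ * A.length) x.1 ++ stageConcat ξ (l.map Prod.fst))) < c) ∧
      StageCond ξ w c δ A (fun s b => F (shiftD (omega0 ^ ξ * A.length) x.1 ++ s)
        (shiftD (omega0 ^ ξ * A.length) x.1 ++ b)) l

theorem outcomeAntitone_stageCond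
    (w : List (Ordinal.{u} × D) → (List (Ordinal.{u} × D) → ℝ) → ℝ) (c δ : ℝ) (A : List Bool)
    (F : List (Ordinal.{u} × D) → List (Ordinal.{u} × D) → ℝ) :
    OutcomeAntitone (StageCond ξ w c δ A F) := by
  induction A generalizing F with
  | nil => intro l l' _ _; simp [StageCond]
  | cons a A ih =>
    rintro _ _ (_ | @⟨x, y, l, l', hxy, hl⟩) h
    · exact h
    · have hfst : l.map Prod.fst = l'.map Prod.fst := by
        clear h
        induction hl with
        | nil => rfl
        | cons h _ ih => simp [h.1, ih]
      obtain ⟨h1, h2⟩ := h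
      refine ⟨?_, ?_⟩
      · rw [hfst, hxy.1]
        split_ifs with ha
        · rw [if_pos ha] at h1
          exact fun s hs => h1 s (hxy.2 hs)
        · rwa [if_neg ha] at h1
      · rw [hxy.1]
        exact ih _ _ _ hl h2

theorem stageCond_trivial (A : List Bool) (l : List (Outcome Ordinal.{u} D))
    (h : l.length = A.length) :
    StageCond ξ (fun _ _ => 0) 1 1 A (fun _ _ => 0) l := by
  induction A generalizing l with
  | nil => simp [StageCond]
  | cons a A ih =>
    rcases l with _ | ⟨x, l⟩
    · simp at h
    · exact ⟨by split_ifs <;> simp, ih l (by simpa using h)⟩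

theorem exists_quantization (C : ℝ) {η : ℝ} (hη : 0 < η) :
    ∃ (m : ℕ) (col : ℝ → Fin (m + 1)) (val : Fin (m + 1) → ℝ) (C' : ℝ), (∀ k, |val k| ≤ C') ∧
      ∀ x, |x| ≤ C → val (col x) ≤ x ∧ x ≤ val (col x) + η := by
  let m := ⌊(C + C) / η⌋₊
  let val : Fin (m + 1) → ℝ := fun k => k.1 * η - C
  -- Rounding down to the grid `-C + ηℕ`. For `|x| ≤ C` the index is at most `m`, so the reduction
  -- modulo `m + 1` in `Fin.ofNat` has no effect.
  refine ⟨m, fun x => Fin.ofNat (m + 1) ⌊(x + C) / η⌋₊, val, ∑ k, |val k|, fun k => ?_, fun x hx => ?_⟩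
  · exact Finset.single_le_sum (f := fun k => |val k|) (fun k _ => abs_nonneg _)
      (Finset.mem_univ k)
  · obtain ⟨h1, h2⟩ := abs_le.1 hx
    have hlt : ⌊(x + C) / η⌋₊ < m + 1 := by
      refine Nat.lt_succ_of_le (Nat.floor_le_floor ?_)
      gcongr
    have hpos : 0 ≤ (x + C) / η := div_nonneg (by linarith) hη.le
    have h3 := Nat.floor_le hpos
    have h4 := (Nat.lt_floor_add_one ((x + C) / η)).le
    rw [le_div_iff₀ hη] at h3
    rw [div_le_iff₀ hη] at h4
    simp only [val, Fin.ofNat, Nat.mod_eq_of_lt hlt]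
    constructor <;> linarith

/-- A stage flagged `true` contributes at most `C`, any other stage less than `c`. -/
theorem StageCond.wavg_le [Nonempty D] {c δ C : ℝ} (A : List Bool)
    (F : List (Ordinal.{u} × D) → List (Ordinal.{u} × D) → ℝ) (hF : ∀ s b, |F s b| ≤ C)
    (l : List (Outcome Ordinal.{u} D)) (hl : l.length = A.length)
    (hlS : ∀ x ∈ l, x.1 ∈ maxElts (Omg ξ D)) (h : StageCond ξ (wavg ξ) c δ A F l) :
    (A.length : ℝ) * wavg (ξ + 1) (stageConcat ξ (l.map Prod.fst))
        (fun s => F s (stageConcat ξ (l.map Prod.fst))) ≤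
      A.count true * C + (A.length - A.count true) * c := by
  induction A generalizing F l with
  | nil => simp
  | cons a A ih =>
    rcases l with _ | ⟨x, l⟩
    · simp at hl
    · have hl' : l.length = A.length := by simpa using hl
      have hlen : (l.map Prod.fst).length = A.length := by simpa using hl'
      have hx := hlS x (by simp)
      have ih' := ih _ (fun _ _ => hF _ _) l hl' (fun y hy => hlS y (by simp [hy])) h.2
      have hstep := wavg_stageConcat (bs := l.map Prod.fst) hx
        (by
          intro y hy
          obtain ⟨z, hz, rfl⟩ := List.mem_map.1 hy
          exact hlS z (by simp [hz]))
        (fun s => F s (stageConcat ξ (x.1 :: l.map Prod.fst)))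
      rw [hlen] at hstep
      rw [List.length_cons, List.map_cons, hstep]
      simp only [stageConcat, hlen]
      have h1 := h.1
      rcases a with _ | _
      · simp only [Bool.false_eq_true, if_false] at h1
        rw [List.count_cons_of_ne (by simp)]
        push_cast
        linarith
      · have h2 : wavg ξ x.1 (fun s => F (shiftD (omega0 ^ ξ * A.length) s)
            (shiftD (omega0 ^ ξ * A.length) x.1 ++ stageConcat ξ (l.map Prod.fst))) ≤ C := by
          rw [← wavg_const hx C]
          exact OrdTree.wavg_le hx.1 fun s _ _ => (abs_le.1 (hF _ _)).2
        rw [List.count_cons_self]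
        push_cast
        linarith

variable [Preorder D]

/-- The dichotomy between large and small functions on `Ω_ξ`, for total functions. -/
def Dichotomy (ξ : Ordinal.{u}) (D : Type v) [Preorder D] : Prop :=
  ∀ (F : List (Ordinal.{u} × D) → List (Ordinal.{u} × D) → ℝ) (C : ℝ), (∀ s b, |F s b| ≤ C) →
    ∀ c δ : ℝ, 0 < δ →
      Prunes (Omg ξ D) (Omg ξ D) (fun b M => ∀ s ∈ M, c - δ ≤ F s b) ∨
      Prunes (Omg ξ D) (Omg ξ D) (fun b _ => wavg ξ b (fun s => F s b) < c)

/-- For an indicator that depends on the branch alone, with `c = 1` and `δ = 1/2`, values at least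
`1/2` are `1`, and averages below `1` are `0` because the weights sum to `1`. -/
theorem Dichotomy.isRamsey [Nonempty D] (h : Dichotomy ξ D) : IsRamsey (Omg ξ D) := by
  classical
  refine isRamsey_of_split (maxElts_Omg_nonempty ξ) fun V => ?_
  rcases h (fun _ b => if V b then 1 else 0) 1 (fun _ b => by split_ifs <;> simp) 1 (1 / 2)
    (by norm_num) with ⟨Q, hQ⟩ | ⟨Q, hQ⟩
  · refine ⟨Q, Or.inl fun τ hτ => ?_⟩
    have := hQ τ hτ (Q.θ τ) ⟨τ, hτ.1, List.prefix_rfl, rfl⟩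
    by_contra hV
    rw [if_neg hV] at this
    norm_num at this
  · refine ⟨Q, Or.inr fun τ hτ hV => ?_⟩
    have := hQ τ hτ
    simp only [if_pos hV, wavg_const (Q.map_max τ hτ)] at this
    exact lt_irrefl _ this

/-- The later stages are handled before the first: for each branch `b` they have flags and a
strategy, refined so that the rounded values of `F` at the initial segments of `b` form a fixed
vector `k b`. The dichotomy for the resulting `G` decides the first flag, and a last pruning makes
the later flags independent of `b`. -/
theorem Dichotomy.exists_flags [Nonempty D] (h : Dichotomy ξ D) (n : ℕ)
    (F : List (Ordinal.{u} × D) → List (Ordinal.{u} × D) → ℝ) (C : ℝ) (hF : ∀ s b, |F s b| ≤ C)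
    (c : ℝ) {δ : ℝ} (hδ : 0 < δ) :
    ∃ A : List Bool, A.length = n ∧ Strat (Omg ξ D) n (StageCond ξ (wavg ξ) c δ A F) := by
  classical
  induction n generalizing F with
  | zero => exact ⟨[], rfl, by simp [Strat, StageCond]⟩
  | succ n ih =>
    let a : Ordinal.{u} := omega0 ^ ξ * n
    choose A hA hS using fun b => ih (fun s w => F (shiftD a b ++ s) (shiftD a b ++ w))
      (fun _ _ => hF _ _)
    obtain ⟨m, col, val, C', hC', hval⟩ := exists_quantization C (half_pos hδ)
    choose k hk using fun b => (hS b).color h.isRamsey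
      (outcomeAntitone_stageCond (wavg ξ) c δ (A b) _)
      (fun bs (i : Fin b.length) =>
        col (F (shiftD a (b.take (i + 1))) (shiftD a b ++ stageConcat ξ bs)))
    -- An initial segment of `b` is determined by its length; length `i + 1` corresponds to index
    -- `i`.
    let G : List (Ordinal.{u} × D) → List (Ordinal.{u} × D) → ℝ := fun s b =>
      if hs : s.length - 1 < b.length then val (k b ⟨s.length - 1, hs⟩) else 0
    have hG : ∀ s b, |G s b| ≤ C' := by
      intro s b
      simp only [G]
      split_ifs
      · exact hC' _
      · rw [abs_zero]; exact (abs_nonneg _).trans (hC' 0)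
    have hGF : ∀ b bs, (fun i : Fin b.length =>
        col (F (shiftD a (b.take (i + 1))) (shiftD a b ++ stageConcat ξ bs))) = k b →
        ∀ s ∈ Omg ξ D, s <+: b →
          G s b ≤ F (shiftD a s) (shiftD a b ++ stageConcat ξ bs) ∧
          F (shiftD a s) (shiftD a b ++ stageConcat ξ bs) ≤ G s b + δ / 2 := by
      intro b bs hbs s hs hp
      have hpos := List.length_pos_of_ne_nil
        (show s ≠ [] by rintro rfl; exact (isBTree_Omg ξ D).1 hs)
      have hle := hp.length_le
      have hlt : s.length - 1 < b.length := by omega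
      have htake : b.take (s.length - 1 + 1) = s := by
        rw [Nat.sub_add_cancel hpos]
        exact (List.prefix_iff_eq_take.1 hp).symm
      have h1 := congrFun hbs ⟨s.length - 1, hlt⟩
      simp only [htake] at h1
      simp only [G, dif_pos hlt, ← h1]
      exact hval _ (hF _ _)
    -- The threshold `c - δ / 2` leaves `δ / 2` for the rounding error when averages of `G` are
    -- compared with those of `F`.
    obtain ⟨flag, P, hP⟩ : ∃ flag : Bool, Prunes (Omg ξ D) (Omg ξ D) (fun b M =>
        if flag then ∀ s ∈ M, c - δ ≤ G s b else wavg ξ b (fun s => G s b) < c - δ / 2) := by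
      rcases h G C' hG (c - δ / 2) (δ / 2) (half_pos hδ) with h | h
      · refine ⟨true, h.mono fun b _ M _ hM => ?_⟩
        rw [if_pos rfl]
        intro s hs
        linarith [hM s hs]
      · exact ⟨false, by simpa using h⟩
    have : Finite {A : List Bool // A.length = n} :=
      inferInstanceAs (Finite (List.Vector Bool n))
    obtain ⟨⟨B, hB⟩, Q, hQ⟩ := h.isRamsey {A : List Bool // A.length = n}
      (fun τ => ⟨A (P.e τ), hA _⟩)
    refine ⟨flag :: B, by simp [hB], P.comp Q, fun τ hτ => ?_⟩
    have hQB : A (P.e (Q.e τ)) = B := congrArg Subtype.val (hQ τ hτ)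
    have hmax := (P.comp Q).map_max τ hτ
    refine (hk (P.e (Q.e τ))).mono fun l _ _ hl => ?_
    have hcmp := hGF _ _ hl.2
    rw [StageCond, hB]
    refine ⟨?_, hQB ▸ hl.1⟩
    have hPQ := hP _ (Q.map_max τ hτ)
    dsimp only at hPQ
    split_ifs with hflag
    · rw [if_pos hflag] at hPQ
      intro s hs
      have hs' := (P.comp Q).marks_spec hτ s hs
      exact (hPQ s (P.marks_comp_subset Q hτ hs)).trans (hcmp s hs'.1 hs'.2).1
    · rw [if_neg hflag] at hPQ
      have := wavg_le hmax.1 (fun s hs hp => (hcmp s hs hp).2)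
      rw [wavg_add, wavg_const hmax] at this
      change wavg ξ (P.e (Q.e τ)) _ ≤ wavg ξ (P.e (Q.e τ)) _ + _ at this
      exact lt_of_le_of_lt this (by linarith)

/-- Only stages flagged `true` receive marks. Since `F` depends on the complete branch, the
condition on the marks already placed cannot be settled at once; `Φ` carries it through the
remaining stages. -/
theorem Strat.prunes_levelOmg [Nonempty D]
    {w : List (Ordinal.{u} × D) → (List (Ordinal.{u} × D) → ℝ) → ℝ} {c δ : ℝ} (A : List Bool)
    (F : List (Ordinal.{u} × D) → List (Ordinal.{u} × D) → ℝ)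
    (Φ : List (Ordinal.{u} × D) → Prop) (hA : A.count true ≠ 0)
    (h : Strat (Omg ξ D) A.length
      (fun l => Φ (stageConcat ξ (l.map Prod.fst)) ∧ StageCond ξ w c δ A F l)) :
    Prunes (levelOmg ξ D (A.count true)) (levelOmg ξ D A.length)
      (fun b M => Φ b ∧ ∀ s ∈ M, c - δ ≤ F s b) := by
  induction A generalizing F Φ with
  | nil => simp at hA
  | cons a A ih =>
    have hlen : ∀ l : List (Outcome Ordinal.{u} D), l.length = A.length → ∀ b,
        stageConcat ξ (b :: l.map Prod.fst) =
          shiftD (omega0 ^ ξ * A.length) b ++ stageConcat ξ (l.map Prod.fst) := by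
      intro l hl b
      rw [stageConcat, List.length_map, hl]
    rcases a with _ | _
    · obtain ⟨P, hP⟩ := h
      -- At a stage flagged `false` a single outcome suffices, and its branch is inserted unmarked.
      obtain ⟨τ, hτ⟩ := maxElts_Omg_nonempty (D := D) ξ
      rw [List.count_cons_of_ne (by simp)] at hA ⊢
      rw [List.length_cons, levelOmg_succ]
      refine Prunes.concat_skip (isBelow_levelOmg ξ _) (P.map_max τ hτ) ?_
      refine (ih (fun s b => F (shiftD (omega0 ^ ξ * A.length) (P.e τ) ++ s)
        (shiftD (omega0 ^ ξ * A.length) (P.e τ) ++ b))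
        (fun b => Φ (shiftD (omega0 ^ ξ * A.length) (P.e τ) ++ b)) hA ?_).mono ?_
      · refine (hP τ hτ).mono fun l hl _ hl2 => ⟨?_, hl2.2.2⟩
        have := hl2.1
        rwa [List.map_cons, hlen l hl] at this
      · rintro b - M - ⟨h1, h2⟩
        refine ⟨h1, ?_⟩
        rintro _ ⟨s, hs, rfl⟩
        exact h2 s hs
    · rw [List.count_cons_self]
      -- After the last `true` flag the source has no stage left, so one play of the remaining
      -- strategy supplies the end of `e`.
      by_cases hA0 : A.count true = 0
      · rw [hA0, Nat.zero_add, levelOmg_one]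
        refine Prunes.concat_last (A' := Omg ξ D) (a' := omega0 ^ ξ * A.length) ?_ ?_
        · rw [List.length_cons, levelOmg_succ]
          exact Set.subset_union_left
        · refine Prunes.mono h fun b hb M _ hbM => ?_
          obtain ⟨l, hl, hlS, h1, h2⟩ := hbM.exists (maxElts_Omg_nonempty ξ)
          rw [List.map_cons, hlen l hl] at h1
          refine ⟨stageConcat ξ (l.map Prod.fst), ?_, h1, ?_⟩
          · have := stageConcat_mem_maxElts b (l.map Prod.fst) hb (by
              intro y hy
              obtain ⟨z, hz, rfl⟩ := List.mem_map.1 hy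
              exact (hlS z hz).1)
            rwa [hlen l hl, List.length_map, hl] at this
          · rintro _ ⟨s, hs, rfl⟩
            have := h2.1
            rw [if_pos rfl] at this
            exact this s hs
      · obtain ⟨m, hm⟩ := Nat.exists_eq_succ_of_ne_zero hA0
        rw [List.length_cons, levelOmg_succ, levelOmg_succ]
        refine Prunes.concat (isBelow_levelOmg ξ _) (isBelow_levelOmg ξ _)
          (by rw [hm]; exact levelOmg_nonempty ξ m) (maxElts_Omg_nonempty ξ) ?_ ?_
        · exact fun b M N hMN hN => ⟨hN.1, fun s hs => hN.2 s (hMN hs)⟩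
        · refine Prunes.mono h fun b _ M _ hbM => ?_
          refine (ih (fun s w => F (shiftD (omega0 ^ ξ * A.length) b ++ s)
            (shiftD (omega0 ^ ξ * A.length) b ++ w))
            (fun w => Φ (shiftD (omega0 ^ ξ * A.length) b ++ w) ∧
              ∀ s ∈ M, c - δ ≤ F (shiftD (omega0 ^ ξ * A.length) s)
                (shiftD (omega0 ^ ξ * A.length) b ++ w)) hA0 ?_).mono ?_
          · refine hbM.mono fun l hl _ hl2 => ⟨⟨?_, ?_⟩, hl2.2.2⟩
            · have := hl2.1
              rwa [List.map_cons, hlen l hl] at this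
            · have := hl2.2.1
              rwa [if_pos rfl] at this
          · rintro w - N - ⟨⟨h1, h2⟩, h3⟩
            refine ⟨h1, ?_⟩
            rintro _ (⟨s, hs, rfl⟩ | ⟨s, hs, rfl⟩)
            · exact h2 s hs
            · exact h3 s hs

/-- The first `i` of `j` stages are flagged `true`, with a condition that always holds. -/
theorem nonempty_pruneMap_levelOmg [Nonempty D] {i j : ℕ} (h : i ≤ j) :
    Nonempty (PruneMap (levelOmg ξ D i) (levelOmg ξ D j)) := by
  rcases Nat.eq_zero_or_pos i with rfl | hi
  · rw [levelOmg_zero]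
    exact ⟨⟨id, id, by simp, by simp [maxElts], by simp, by simp, by simp [maxElts]⟩⟩
  · let A := List.replicate i true ++ List.replicate (j - i) false
    have h1 : A.count true = i := by simp [A, List.count_replicate]
    have h2 : A.length = j := by simp [A, h]
    have := Strat.prunes_levelOmg (ξ := ξ) (D := D) (w := fun _ _ => 0) (c := 1) (δ := 1) A
      (fun _ _ => 0) (fun _ => True) (by omega)
      ((Strat.trivial (Φ := fun _ => True) _ _ fun _ => True.intro).mono
        fun l hl _ _ => ⟨True.intro, stageCond_trivial A l hl⟩)
    rw [h1, h2] at this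
    obtain ⟨P, -⟩ := this
    exact ⟨P⟩

/-- With all flags `true`, a strategy is exactly a pruning of the concatenation; the stage condition
is again vacuous. -/
theorem Strat.prunes_self [Nonempty D] {n : ℕ} (hn : n ≠ 0)
    {Φ : List (Ordinal.{u} × D) → Prop}
    (h : Strat (Omg ξ D) n (fun l => Φ (stageConcat ξ (l.map Prod.fst)))) :
    Prunes (levelOmg ξ D n) (levelOmg ξ D n) (fun b _ => Φ b) := by
  have h1 : (List.replicate n true).count true = n := by simp
  have h2 : (List.replicate n true).length = n := by simp
  have := Strat.prunes_levelOmg (ξ := ξ) (D := D) (w := fun _ _ => 0) (c := 1) (δ := 1)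
    (List.replicate n true) (fun _ _ => 0) Φ (by rwa [h1])
    (by
      rw [h2]
      exact h.mono fun l hl _ hΦ => ⟨hΦ, stageCond_trivial _ l (by rw [hl, h2])⟩)
  rw [h1, h2] at this
  exact this.mono fun b _ M _ h => h.1

end Stages

/-! ### The induction on `ξ` and the theorem. -/

section Main

open Ordinal

variable {D : Type v} {ξ : Ordinal.{u}}

theorem markAntitone_large (F : List (Ordinal.{u} × D) → List (Ordinal.{u} × D) → ℝ) (c : ℝ) :
    MarkAntitone (fun b M => ∀ s ∈ M, c ≤ F s b) :=
  fun _ _ _ hMN h s hs => h s (hMN hs)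

theorem markAntitone_const (Φ : List (Ordinal.{u} × D) → Prop) :
    MarkAntitone (fun b _ => Φ b) :=
  fun _ _ _ _ h => h

theorem exists_of_mem_Omg_zero {τ : List (Ordinal.{u} × D)} (h : τ ∈ Omg 0 D) :
    ∃ d, τ = [(0, d)] := by
  rw [Omg, Gam_zero] at h
  obtain ⟨x, l, rfl, hx, hl⟩ := List.map_eq_cons_iff.1 (show τ.map Prod.fst = [0] from h)
  obtain rfl : l = [] := by simpa using hl
  exact ⟨x.2, by rw [← hx]⟩

theorem singleton_mem_maxElts_Omg_zero (d : D) : [((0 : Ordinal.{u}), d)] ∈ maxElts (Omg 0 D) := by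
  refine ⟨by rw [Omg, Gam_zero]; rfl, fun s hs hp => ?_⟩
  obtain ⟨d', rfl⟩ := exists_of_mem_Omg_zero hs
  simpa [eq_comm] using hp

open Classical in
/-- The extension of `g` by zero to all pairs of sequences. -/
noncomputable def extendZero (g : branchPairs (Omg ξ D) → ℝ)
    (s b : List (Ordinal.{u} × D)) : ℝ :=
  if h : (s, b) ∈ branchPairs (Omg ξ D) then g ⟨(s, b), h⟩ else 0

theorem extendZero_apply (g : branchPairs (Omg ξ D) → ℝ) (q : branchPairs (Omg ξ D)) :
    extendZero g q.1.1 q.1.2 = g q :=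
  dif_pos q.2

theorem wavg_extendZero (g : branchPairs (Omg ξ D) → ℝ) (τ : maxElts (Omg ξ D)) :
    wavg ξ τ.1 (fun s => extendZero g s τ.1) = branchAvg g τ := by
  rw [wavg, branchAvg, ← Fin.sum_univ_eq_sum_range
    (fun i => prob ξ ((τ.1.take (i + 1)).map Prod.fst) * extendZero g (τ.1.take (i + 1)) τ.1)]
  exact Finset.sum_congr rfl fun i _ => by rw [← extendZero_apply g (initPair τ i)]; rfl

variable [Preorder D]

/-- The pruning of `Ω_0` defined by an expansive map of `D`. -/
def zeroMap (φ : D → D) (hφ : ∀ d, d ≤ φ d) :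
    PruneMap (Omg (0 : Ordinal.{u}) D) (Omg (0 : Ordinal.{u}) D) where
  θ := List.map (Prod.map id φ)
  e := List.map (Prod.map id φ)
  map_mem τ h := by
    obtain ⟨d, rfl⟩ := exists_of_mem_Omg_zero h
    exact (singleton_mem_maxElts_Omg_zero _).1
  map_max τ h := by
    obtain ⟨d, rfl⟩ := exists_of_mem_Omg_zero h.1
    exact singleton_mem_maxElts_Omg_zero _
  mono τ h τ' h' hp hne := by
    obtain ⟨d, rfl⟩ := exists_of_mem_Omg_zero h
    obtain ⟨d', rfl⟩ := exists_of_mem_Omg_zero h'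
    exact absurd (by simpa using hp) hne
  le_last τ h x hx := by
    obtain ⟨d, rfl⟩ := exists_of_mem_Omg_zero h
    obtain rfl : (0, d) = x := by simpa using hx
    exact ⟨(0, φ d), by simp, hφ d⟩
  prefix_e _ _ := List.prefix_rfl

theorem dichotomy_zero [IsDirectedOrder D] : Dichotomy (0 : Ordinal.{u}) D := by
  intro F C _ c δ hδ
  by_cases h : ∃ d, ∀ d', d ≤ d' → c ≤ F [(0, d')] [(0, d')]
  · obtain ⟨d, hd⟩ := h
    choose φ h1 h2 using fun d' => directed_of (· ≤ ·) d d'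
    refine Or.inl ⟨zeroMap φ h2, fun τ hτ => ?_⟩
    rintro _ ⟨s, hs, hp, rfl⟩
    obtain ⟨d₁, rfl⟩ := exists_of_mem_Omg_zero hs
    obtain ⟨d₂, rfl⟩ := exists_of_mem_Omg_zero hτ.1
    obtain rfl : d₁ = d₂ := by simpa using hp
    have := hd _ (h1 d₁)
    simp only [zeroMap, List.map_cons, List.map_nil, Prod.map, id]
    linarith
  · push Not at h
    choose φ h1 h2 using h
    refine Or.inr ⟨zeroMap φ h1, fun τ hτ => ?_⟩
    obtain ⟨d, rfl⟩ := exists_of_mem_Omg_zero hτ.1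
    simpa [zeroMap, wavg, prob_zero] using h2 d

theorem Prunes.image_shiftD {a : Ordinal.{u}} {T : Set (List (Ordinal.{u} × D))}
    {Ψ : List (Ordinal.{u} × D) → Set (List (Ordinal.{u} × D)) → Prop} (hΨ : MarkAntitone Ψ)
    (h : Prunes T T (fun b M => Ψ (shiftD a b) (shiftD a '' M))) :
    Prunes (shiftD a '' T) (shiftD a '' T) Ψ :=
  (Prunes.postcomp (shiftMap a T) h).precomp hΨ (unshiftMap a T)

/-- If the large alternative is not available on cofinally many components, then from some index on
every component satisfies the small one. -/
theorem dichotomy_limit (hξ : Order.IsSuccLimit ξ) (ih : ∀ ζ < ξ, Dichotomy (ζ + 1) D) :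
    Dichotomy ξ D := by
  intro F C hF c δ hδ
  have comp := isComponents_limit (D := D) hξ
  have emb : ∀ i j : Set.Iio ξ, i ≤ j → Nonempty (PruneMap
      (shiftD (omega0 ^ i.1) '' Omg (i.1 + 1) D) (shiftD (omega0 ^ j.1) '' Omg (j.1 + 1) D)) := by
    intro i j hij
    obtain ⟨P⟩ := nonempty_pruneMap_Omg (D := D) (show i.1 + 1 ≤ j.1 + 1 by gcongr)
    exact ⟨(shiftMap _ _).comp (P.comp (unshiftMap _ _))⟩
  by_cases h : ∀ i : Set.Iio ξ, ∃ j, i ≤ j ∧ Prunes (shiftD (omega0 ^ j.1) '' Omg (j.1 + 1) D)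
      (Omg ξ D) (fun b M => ∀ s ∈ M, c - δ ≤ F s b)
  · exact Or.inl (comp.prunes_of_cofinal emb (markAntitone_large _ _) h)
  · push Not at h
    obtain ⟨i, hi⟩ := h
    refine Or.inr (comp.prunes_of_cofinal emb (markAntitone_const _) fun k =>
      ⟨max i k, le_max_right _ _, ?_⟩)
    refine comp.prunes_incl (max i k) ?_
    rcases ih (max i k).1 (max i k).2 (fun s b => F (shiftD _ s) (shiftD _ b)) C
      (fun _ _ => hF _ _) c δ hδ with h | h
    · refine absurd ?_ (hi (max i k) (le_max_left _ _))
      refine comp.prunes_incl (max i k) (Prunes.image_shiftD (markAntitone_large _ _) ?_)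
      refine h.mono fun b _ M _ hM => ?_
      rintro _ ⟨s, hs, rfl⟩
      exact hM s hs
    · refine Prunes.image_shiftD (markAntitone_const _) ?_
      refine h.mono fun b hb M _ hM => ?_
      rw [wavg_limit hξ (max i k).2 hb.1]
      exact hM

theorem dichotomy_add_one [Nonempty D] (ih : Dichotomy ξ D) : Dichotomy (ξ + 1) D := by
  intro F C hF c δ hδ
  have comp := isComponents_add_one (D := D) ξ
  by_cases h : ∀ i : ℕ, ∃ j, i ≤ j ∧ Prunes (levelOmg ξ D j) (Omg (ξ + 1) D)
      (fun b _ => wavg (ξ + 1) b (fun s => F s b) < c)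
  · exact Or.inr (comp.prunes_of_cofinal (fun _ _ => nonempty_pruneMap_levelOmg)
      (markAntitone_const _) h)
  · push Not at h
    obtain ⟨i, hi⟩ := h
    refine Or.inl (comp.prunes_of_cofinal (fun _ _ => nonempty_pruneMap_levelOmg)
      (markAntitone_large _ _) fun k => ?_)
    have hδ2 := half_pos hδ
    have hC : 0 ≤ C := (abs_nonneg _).trans (hF [] [])
    -- At most `k + 1` stages flagged `true` raise the sum of `n` stage averages above `n (c - δ /
    -- 2)` by at most `(k + 1)(C + |c - δ / 2|)`; for `n ≥ N` this is less than `n δ / 2`, so the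
    -- mean stays below `c`.
    obtain ⟨N, hN⟩ := exists_nat_gt ((k + 1 : ℕ) * (C + |c - δ / 2|) / (δ / 2))
    rw [div_lt_iff₀ hδ2] at hN
    -- Taking `i + 1` rather than `i` also makes `n` positive.
    let n := max N (i + 1)
    have hnN : ((k + 1 : ℕ) : ℝ) * (C + |c - δ / 2|) < n * (δ / 2) :=
      hN.trans_le (by gcongr; exact le_max_left _ _)
    have hin : i + 1 ≤ n := le_max_right _ _
    obtain ⟨A, hA, hS⟩ := ih.exists_flags n F C hF (c - δ / 2) hδ2
    -- Many large stages give a large pruning of a level beyond `k`; few would give a small pruning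
    -- of level `n`, which the choice of `i` excludes.
    by_cases hk : k + 1 ≤ A.count true
    · refine ⟨A.count true, by omega, ?_⟩
      have := Strat.prunes_levelOmg A F (fun _ => True) (by omega)
        (by rw [hA]; exact hS.mono fun l _ _ hl => ⟨True.intro, hl⟩)
      refine comp.prunes_incl A.length (this.mono fun b _ M _ hM s hs => ?_)
      linarith [hM.2 s hs]
    · refine absurd ?_ (hi n (by omega))
      refine comp.prunes_incl n (Strat.prunes_self (by omega) (hS.mono fun l hl hlS hcond => ?_))
      have hsum := StageCond.wavg_le A F hF l (by rw [hl, hA]) (fun x hx => (hlS x hx).1) hcond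
      rw [hA] at hsum
      have hcount : (A.count true : ℝ) ≤ (k + 1 : ℕ) := by exact_mod_cast (not_le.1 hk).le
      have h1 : (A.count true : ℝ) * (C - (c - δ / 2)) ≤ (k + 1 : ℕ) * (C + |c - δ / 2|) := by
        refine (mul_le_mul_of_nonneg_left ?_ (Nat.cast_nonneg _)).trans
          (mul_le_mul_of_nonneg_right hcount (by positivity))
        linarith [neg_abs_le (c - δ / 2)]
      have hn : (0 : ℝ) < n := by exact_mod_cast (by omega : 0 < n)
      refine lt_of_mul_lt_mul_left (hsum.trans_lt ?_) hn.le
      linarith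

theorem dichotomy [Nonempty D] [IsDirectedOrder D] (ξ : Ordinal.{u}) : Dichotomy ξ D := by
  induction ξ using Ordinal.limitRecOn with
  | zero => exact dichotomy_zero
  | add_one ξ ih => exact dichotomy_add_one ih
  | limit ξ hξ ih => exact dichotomy_limit hξ fun ζ hζ => ih _ (hξ.add_one_lt hζ)

/-- Smallness does not involve `δ`, so if it fails, the dichotomy yields its large alternative for
every `δ`. -/
theorem isLarge_or_isSmall [Nonempty D] [IsDirectedOrder D] (g : branchPairs (Omg ξ D) → ℝ)
    {C : ℝ} (hg : ∀ q, |g q| ≤ C) (ε : ℝ) : IsLarge g ε ∨ IsSmall g ε := by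
  have hbound : ∀ s b, |extendZero g s b| ≤ |C| := by
    intro s b
    rw [extendZero]
    split_ifs
    · exact (hg _).trans (le_abs_self C)
    · simp
  by_cases hsmall : IsSmall g ε
  · exact Or.inr hsmall
  · refine Or.inl fun δ hδ => ?_
    rcases dichotomy ξ (extendZero g) |C| hbound ε δ hδ with ⟨P, hP⟩ | ⟨P, hP⟩
    · refine ⟨P.toExt, fun q => ?_⟩
      rw [← extendZero_apply g (P.toExt.mapPair q)]
      exact hP q.1.2 q.2.2.1 _ ⟨q.1.1, q.2.1, q.2.2.2, rfl⟩
    · refine absurd ⟨P.toExt, fun τ => ?_⟩ hsmall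
      rw [← wavg_extendZero]
      exact hP τ.1 τ.2

/-- Directedness here allows an empty `D`; then `Ω_ξ` is empty, as `Γ_ξ` has no empty sequence. -/
theorem isLarge_of_isEmpty [IsEmpty D] (g : branchPairs (Omg ξ D) → ℝ) (ε : ℝ) :
    IsLarge g ε := by
  have hΩ : ∀ τ, τ ∉ Omg ξ D := by
    rintro (_ | ⟨x, τ⟩) h
    · exact (isBTree_Omg ξ D).1 h
    · exact isEmptyElim x.2
  exact fun δ _ => ⟨(PruneMap.refl _).toExt, fun q => absurd q.2.1 (hΩ _)⟩

theorem isLarge_of_le_branchAvg [IsDirectedOrder D] (g : branchPairs (Omg ξ D) → ℝ) {C : ℝ}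
    (hg : ∀ q, |g q| ≤ C) {ε : ℝ} (h : ∀ τ : maxElts (Omg ξ D), ε ≤ branchAvg g τ) :
    IsLarge g ε := by
  rcases isEmpty_or_nonempty D with _ | _
  · exact isLarge_of_isEmpty g ε
  · refine (isLarge_or_isSmall g hg ε).resolve_right ?_
    rintro ⟨P, hP⟩
    obtain ⟨τ, hτ⟩ := maxElts_Omg_nonempty (D := D) ξ
    exact (hP ⟨τ, hτ⟩).not_ge (h _)

end Main

end OrdTree

theorem mainTheorem8 (ξ : Ordinal.{u}) (D : Type v) [Preorder D] [IsDirectedOrder D] :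
    (∀ g : OrdTree.branchPairs (OrdTree.Omg ξ D) → ℝ, (∀ q, g q ∈ Set.Icc (-1 : ℝ) 1) →
      ∀ ε : ℝ, OrdTree.IsLarge g ε ∨ OrdTree.IsSmall g ε) ∧
    (∀ g : OrdTree.branchPairs (OrdTree.Omg ξ D) → ℝ, (∃ C : ℝ, ∀ q, |g q| ≤ C) →
      ∀ ε : ℝ, (∀ τ : OrdTree.maxElts (OrdTree.Omg ξ D), ε ≤ OrdTree.branchAvg g τ) →
        OrdTree.IsLarge g ε) := by
  refine ⟨fun g hg ε => ?_, fun g ⟨C, hC⟩ ε h => OrdTree.isLarge_of_le_branchAvg g hC h⟩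
  rcases isEmpty_or_nonempty D with _ | _
  · exact Or.inl (OrdTree.isLarge_of_isEmpty g ε)
  · exact OrdTree.isLarge_or_isSmall g (fun q => abs_le.2 (hg q)) ε
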